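/- **Theorem 2.2.** Let $\mathrm X$ be a countable set and let $p=(p(x,y))_{x,y\in\mathrm X}$ be an irreducible transition probability on $\mathrm X$ with $\sup_{y}\sum_{x}p(x,y)<\infty$. Let $a:\mathrm X\to(0,\infty)$ and $M$ be such that $\sum_x a_x<\infty$ and $\sum_y p(x,y)a_y+\sum_y a_y p(y,x)\le M a_x$ for every $x\in\mathrm X$. Let $g^k_{\alpha,\beta}$ ($k,\alpha,\beta\in\mathbb N=\{0,1,\dots\}$) be real numbers with $g^0_{\alpha,\beta}=0$, $g^k_{\alpha,\beta}\ge 0$ for $0<k\le\alpha$, and $g^k_{\alpha,\beta}=0$ for $k>\alpha$ or $\alpha=0$. Assume that there is a constant $C>0$ such that $$\sum_{k=1}^{\alpha\vee\gamma}k\,|g^k_{\alpha,\beta}-g^k_{\gamma,\delta}|\le C(|\alpha-\gamma|+|\beta-\delta|)\qquad\text{for all }\alpha,\beta,\gamma,\delta\ge 0 .$$ Put $\mathfrak X=\{\eta\in\mathbb N^{\mathrm X}:\sum_x\eta(x)a_x<\infty\}$ and $\|\eta-\zeta\|=\sum_x|\eta(x)-\zeta(x)|a_x$ for $\eta,\zeta\in\mathfrak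 X$, and let $\mathbf L$ be the vector space of functions $f:\mathfrak X\to\mathbb R$ that are Lipschitz for this distance. For $f\in\mathbf L$ and $\eta\in\mathfrak X$ let $$\mathcal Lf(\eta)=\sum_{x,y\in\mathrm X}\sum_{k>0}p(x,y)\,g^k_{\eta(x),\eta(y)}\bigl(f(\mathcal S^k_{x,y}\eta)-f(\eta)\bigr),$$ where $\mathcal S^k_{x,y}\eta$ is obtained from $\eta$ by moving $k$ particles from $x$ to $y$ if $\eta(x)\ge k$ and $x\ne y$, and $\mathcal S^k_{x,y}\eta=\eta$ otherwise. Then this series converges absolutely, and there exist a constant $c>0$ and a Markov semigroup $(S(t))_{t\ge0}$ of linear operators on $\mathbf L$ (that is, $S(0)=I$, $S(s+t)=S(s)S(t)$, $S(t)1=1$, $S(t)f\ge0$ whenever $f\ge0$, and $t\mapsto S(t)f(\eta)$ is continuous) such that for all $f\in\mathbf L$ and $t\ge0$: 1. if $f$ is Lipschitz with constant $L_f$, then $S(t)f$ is Lipschitz with constant $L_fe^{ct}$; 2. for all $\eta\in\mathfrak X$, the function $s\mapsto\mathcal LS(s)f(\eta)$ is integrable on $[0,t]$ and $S(t)f(\eta)=f(\eta)+\int_0^t\mathcal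 LS(s)f(\eta)\,ds$; 3. if $\sum_x\eta(x)<\infty$, then $S(t)f(\eta)=\mathbb E^{\eta}f(\eta_t)$, where $(\eta_t)_{t\ge0}$ is a continuous-time Markov chain, started at $\eta_0=\eta$, on the countable set of configurations with finitely many particles, in which each jump $\xi\to\mathcal S^k_{x,y}\xi$ has rate $p(x,y)g^k_{\xi(x),\xi(y)}$. More precisely, there is a Markov transition function $P_t(\xi,\zeta)$ on this set (honest, with the $Q$-matrix given by these rates as its derivative at $t=0$) such that $S(t)f(\eta)=\sum_\zeta P_t(\eta,\zeta)f(\zeta)$ with absolute convergence. Moreover, for every process $(\eta_t)_{t\ge0}$ with $\eta_0=\eta$ a.s. whose finite-dimensional distributions are given by a transition function with this $Q$-matrix, $f(\eta_t)$ is integrable and $S(t)f(\eta)=\mathbb E f(\eta_t)$. -/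

import Mathlib

open scoped NNReal Topology

noncomputable section

namespace MassMigration

/-! ### Data of the model -/

/-- `p` is a transition probability on `X`. -/
structure IsTransitionProbability {X : Type*} (p : X → X → ℝ) : Prop where
  nonneg : ∀ x y, 0 ≤ p x y
  hasSum_one : ∀ x, HasSum (p x) 1

/-- The column sums of `p` are bounded: `sup_y ∑_x p(x,y) < ∞`. -/
def HasBoundedColumnSums {X : Type*} (p : X → X → ℝ) : Prop :=
  ∃ m : ℝ, ∀ y, Summable (fun x => p x y) ∧ ∑' x, p x y ≤ m

/-- Admissible rates; `g k α β` is the rate, up to the factor `p(x,y)`, at which `k` particles jump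
from a site occupied by `α` particles to a site occupied by `β` particles. -/
structure IsRateFunction (g : ℕ → ℕ → ℕ → ℝ) : Prop where
  zero : ∀ α β, g 0 α β = 0
  nonneg : ∀ k α β, 0 < k → k ≤ α → 0 ≤ g k α β
  eq_zero : ∀ k α β, α < k ∨ α = 0 → g k α β = 0

/-- The Lipschitz-type condition on the rates, with constant `C`. -/
def LipschitzRates (g : ℕ → ℕ → ℕ → ℝ) (C : ℝ) : Prop :=
  ∀ α β γ δ : ℕ, ∑ k ∈ Finset.Icc 1 (max α γ), (k : ℝ) * |g k α β - g k γ δ| ≤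
    C * (|(α : ℝ) - γ| + |(β : ℝ) - δ|)

/-- A positive summable weight `a` with
`∑_y p(x,y) a_y + ∑_y a_y p(y,x) ≤ M a_x` for every `x`. -/
structure IsWeight {X : Type*} (p : X → X → ℝ) (a : X → ℝ) (M : ℝ) : Prop where
  pos : ∀ x, 0 < a x
  summable : Summable a
  bound : ∀ x, ∑' y, p x y * a y + ∑' y, a y * p y x ≤ M * a x

/-! ### Configurations -/

/-- The configurations `η : X → ℕ` with `‖η‖ = ∑_x η(x) a_x < ∞`. -/
def Config {X : Type*} (a : X → ℝ) : Type _ :=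
  {η : X → ℕ // Summable fun x => (η x : ℝ) * a x}

/-- The weighted distance `‖η - ζ‖ = ∑_x |η(x) - ζ(x)| a_x`. -/
def wdist {X : Type*} {a : X → ℝ} (η ζ : Config a) : ℝ :=
  ∑' x, |(η.1 x : ℝ) - (ζ.1 x : ℝ)| * a x

open Classical in
/-- The configuration obtained from `η` by moving `k` particles from `x` to `y`; it is `η` itself
if `x` holds fewer than `k` particles, or if `x = y`. -/
def jump {X : Type*} (x y : X) (k : ℕ) (η : X → ℕ) : X → ℕ := fun z =>
  if k ≤ η x ∧ x ≠ y then
    if z = x then η x - k else if z = y then η y + k else η z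
  else η z

theorem summable_jump {X : Type*} {a : X → ℝ} (x y : X) (k : ℕ) (η : Config a) :
    Summable fun z => (jump x y k η.1 z : ℝ) * a z := by
  refine η.2.congr_cofinite ?_
  have h : ({x, y} : Set X).Finite := Set.toFinite _
  filter_upwards [h.compl_mem_cofinite] with z hz
  simp only [Set.mem_compl_iff, Set.mem_insert_iff, Set.mem_singleton_iff, not_or] at hz
  simp [jump, hz.1, hz.2]

/-- Jumps as maps of the space of configurations of finite weight. -/
def Config.jump {X : Type*} {a : X → ℝ} (x y : X) (k : ℕ) (η : Config a) : Config a :=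
  ⟨MassMigration.jump x y k η.1, summable_jump x y k η⟩

/-- A configuration with finitely many particles, as an element of `Config a`. -/
def ofFinite {X : Type*} (a : X → ℝ) (ζ : X →₀ ℕ) : Config a :=
  ⟨ζ, summable_of_hasFiniteSupport (ζ.hasFiniteSupport.subset fun x hx => by
    simp only [Function.mem_support] at hx ⊢
    intro h
    exact hx (by simp [h]))⟩

/-! ### Lipschitz functions, generator, semigroup -/

/-- `f` is Lipschitz with constant `K` for the weighted distance. -/
def IsLip {X : Type*} {a : X → ℝ} (K : ℝ) (f : Config a → ℝ) : Prop :=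
  ∀ η ζ, |f η - f ζ| ≤ K * wdist η ζ

/-- The vector space of real Lipschitz functions on `Config a`. As `wdist` is nonnegative for
positive weights, it makes no difference whether the constant is required to be positive. -/
def Lip {X : Type*} (a : X → ℝ) : Submodule ℝ (Config a → ℝ) where
  carrier := {f | ∃ K, IsLip K f}
  zero_mem' := ⟨0, fun η ζ => by simp⟩
  add_mem' := by
    rintro f₁ f₂ ⟨K₁, h₁⟩ ⟨K₂, h₂⟩
    refine ⟨K₁ + K₂, fun η ζ => ?_⟩
    have e : (f₁ + f₂) η - (f₁ + f₂) ζ = (f₁ η - f₁ ζ) + (f₂ η - f₂ ζ) := by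
      simp only [Pi.add_apply]; ring
    rw [e, add_mul]
    exact (abs_add_le _ _).trans (add_le_add (h₁ η ζ) (h₂ η ζ))
  smul_mem' := by
    rintro c f ⟨K, h⟩
    refine ⟨|c| * K, fun η ζ => ?_⟩
    have e : (c • f) η - (c • f) ζ = c * (f η - f ζ) := by
      simp only [Pi.smul_apply, smul_eq_mul]; ring
    rw [e, abs_mul, mul_assoc]
    exact mul_le_mul_of_nonneg_left (h η ζ) (abs_nonneg c)

/-- The constant function `1` as a Lipschitz function. -/
def Lip.one {X : Type*} (a : X → ℝ) : Lip a :=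
  ⟨fun _ => 1, 0, fun η ζ => by simp⟩

/-- The summands of the generator. -/
def generatorTerm {X : Type*} {a : X → ℝ} (p : X → X → ℝ) (g : ℕ → ℕ → ℕ → ℝ)
    (f : Config a → ℝ) (η : Config a) (i : X × X × ℕ) : ℝ :=
  p i.1 i.2.1 * g i.2.2 (η.1 i.1) (η.1 i.2.1) * (f (η.jump i.1 i.2.1 i.2.2) - f η)

/-- The generator
`ℒ f(η) = ∑_{x,y} ∑_k p(x,y) g^k_{η(x),η(y)} (f(S^k_{x,y} η) - f(η))`;
the term `k = 0` vanishes. -/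
def generator {X : Type*} {a : X → ℝ} (p : X → X → ℝ) (g : ℕ → ℕ → ℕ → ℝ)
    (f : Config a → ℝ) (η : Config a) : ℝ :=
  ∑' i, generatorTerm p g f η i

/-- A Markov semigroup of linear operators on the Lipschitz functions: the semigroup property,
preservation of constants, positivity, and continuity in time. -/
structure IsMarkovSemigroup {X : Type*} {a : X → ℝ} (S : ℝ≥0 → Lip a →ₗ[ℝ] Lip a) : Prop where
  zero : S 0 = LinearMap.id
  add : ∀ s t, S (s + t) = S s ∘ₗ S t
  one : ∀ t, S t (Lip.one a) = Lip.one a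
  nonneg : ∀ t (f : Lip a), (∀ η, 0 ≤ f.1 η) → ∀ η, 0 ≤ (S t f).1 η
  continuous : ∀ (f : Lip a) η, Continuous fun t => (S t f).1 η

/-! ### Continuous-time Markov chains on a countable state space -/

/-- The `Q`-matrix of the model on the configurations with finitely many particles: off the diagonal
`chainRate p g η ζ` is the total rate of the jumps from `η` to `ζ`, on the diagonal it is minus the
total rate of the jumps that leave `η`. -/
def chainRate {X : Type*} (p : X → X → ℝ) (g : ℕ → ℕ → ℕ → ℝ) (η ζ : X →₀ ℕ) : ℝ :=
  open Classical in
  ∑' i : X × X × ℕ, p i.1 i.2.1 * g i.2.2 (η i.1) (η i.2.1) *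
    ((if jump i.1 i.2.1 i.2.2 η = ζ then 1 else 0) - (if η = ζ then 1 else 0))

/-- `P` is an (honest, standard) Markov transition function with `Q`-matrix `q`. -/
structure IsTransitionFunction {S : Type*} (q : S → S → ℝ) (P : ℝ≥0 → S → S → ℝ) : Prop where
  nonneg : ∀ t i j, 0 ≤ P t i j
  hasSum_one : ∀ t i, HasSum (P t i) 1
  zero_self : ∀ i, P 0 i i = 1
  chapman_kolmogorov : ∀ s t i j, HasSum (fun k => P s i k * P t k j) (P (s + t) i j)
  rate : ∀ i j, Filter.Tendsto (fun h : ℝ≥0 => (P h i j - P 0 i j) / h) (𝓝[>] 0) (𝓝 (q i j))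

/-- `Y` is a continuous-time Markov chain with `Q`-matrix `q` and initial state `i`: its
finite-dimensional distributions are given by a transition function with `Q`-matrix `q`. -/
structure IsMarkovChain {S Ω : Type*} [MeasurableSpace Ω] (q : S → S → ℝ) (i : S)
    (μ : MeasureTheory.Measure Ω) (Y : ℝ≥0 → Ω → S) : Prop where
  measurable : ∀ t j, MeasurableSet {ω | Y t ω = j}
  initial : ∀ᵐ ω ∂μ, Y 0 ω = i
  law : ∃ P, IsTransitionFunction q P ∧
    ∀ (n : ℕ) (t : Fin (n + 1) → ℝ≥0) (x : Fin (n + 1) → S), Monotone t → t 0 = 0 → x 0 = i →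
      μ {ω | ∀ k, Y (t k) ω = x k} =
        ENNReal.ofReal (∏ k : Fin n, P (t k.succ - t k.castSucc) (x k.castSucc) (x k.succ))

end MassMigration

end

/-! With finitely many particles, every jump conserves the particle number, and comparing the rates
with those of an empty departure site bounds the total jump rate from `ξ` by `C * ξ.degree`. If the
rates are switched off above level `N`, the generator is a bounded operator on `ℓ¹` and its
exponential is a transition function. Truncations at different levels agree where both leave the
rates unchanged, because the backward equation determines a transition function on a closed class
with bounded rates (`IsTransitionFunction.eq_of_rates_eqOn`). They therefore glue to one transition
function (`GradedRates.isTransitionFunction`), and the same argument shows that no other has this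
`Q`-matrix (`GradedRates.eq_law`).

The core is the Lipschitz bound `GradedRates.abs_expect_sub_le`, which rests on the basic coupling.
Two configurations perform a common jump together, which leaves their distance unchanged; one of
them performs the jump `(x, y, k)` alone at rate `|r - s|`, which adds at most `k * (a x + a y)`. By
the hypotheses on `g`, `a` and the column sums, the total expansion rate is at most `c * wdist η ζ`
with `c = couplingRate C M m` (`sumLe_coupling`). No coupled process is constructed: for the chain
uniformized at rate `Λ`, one step multiplies Lipschitz constants by at most `1 + c / Λ`
(`step_sub_step_le`), and averaging over a Poisson number of steps gives `exp (c * t)`, whatever `Λ`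
and the truncation level.

Finite configurations are dense, so expectations of Lipschitz functions extend uniquely to `Config
a`. This defines the semigroup, and its algebraic properties and positivity pass to the limit. The
integral equation holds at finite configurations by the backward equation. It extends to all `η` by
restricting `η` to finite sets of sites, using `tendsto_generator_restrict` and dominated
convergence in time; continuity in time follows from it. -/

noncomputable section

namespace JumpProcess

/-! ### The space of summable real families -/

/-- The Banach space of absolutely summable real families on `S`. -/
abbrev L1 (S : Type*) := lp (fun _ : S => ℝ) 1

section L1

variable {S W : Type*} [NormedAddCommGroup W] [NormedSpace ℝ W]

open Classical in
/-- The point mass at `i`. -/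
def unit (i : S) : L1 S := lp.single 1 i 1

open Classical in
theorem unit_apply (i j : S) : unit i j = if j = i then 1 else 0 := by
  simp [unit, lp.single_apply, Pi.single_apply]

theorem unit_self (i : S) : unit i i = 1 := by simp [unit_apply]

theorem unit_of_ne {i j : S} (h : j ≠ i) : unit i j = 0 := by simp [unit_apply, h]

theorem norm_unit (i : S) : ‖unit i‖ = 1 := by
  classical
  simp [unit, lp.norm_single]

theorem summable_abs (μ : L1 S) : Summable fun i => |μ i| := by
  simpa using (lp.memℓp μ).summable (by simp)

theorem norm_eq_tsum_abs (μ : L1 S) : ‖μ‖ = ∑' i, |μ i| := by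
  simpa using lp.norm_eq_tsum_rpow (by simp) μ

theorem hasSum_smul_unit (μ : L1 S) : HasSum (fun i => μ i • unit i) μ := by
  classical
  convert! lp.hasSum_single (E := fun _ : S => ℝ) (by simp) μ using 2 with i
  rw [unit, ← lp.single_smul, smul_eq_mul, mul_one]

theorem hasSum_map (T : L1 S →L[ℝ] W) (μ : L1 S) :
    HasSum (fun i => μ i • T (unit i)) (T μ) := by
  simpa using (hasSum_smul_unit μ).mapL T

theorem ext_unit {T T' : L1 S →L[ℝ] W} (h : ∀ i, T (unit i) = T' (unit i)) : T = T' := by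
  ext1 μ
  have h1 := hasSum_map T μ
  simp only [h] at h1
  exact h1.unique (hasSum_map T' μ)

theorem norm_smul_le_of_bounded {b : S → W} {B : ℝ} (hb : ∀ i, ‖b i‖ ≤ B) (μ : L1 S) (i : S) :
    ‖μ i • b i‖ ≤ |μ i| * B := by
  rw [norm_smul, Real.norm_eq_abs]
  exact mul_le_mul_of_nonneg_left (hb i) (abs_nonneg _)

variable [CompleteSpace W]

theorem summable_smul_of_bounded {b : S → W} (hb : ∃ B, ∀ i, ‖b i‖ ≤ B) (μ : L1 S) :
    Summable fun i => μ i • b i := by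
  obtain ⟨B, hB⟩ := hb
  exact Summable.of_norm_bounded ((summable_abs μ).mul_right B) (norm_smul_le_of_bounded hB μ)

/-- The continuous linear map on `L1 S` that sends the point mass at `i` to `b i`. -/
def lift (b : S → W) (hb : ∃ B, ∀ i, ‖b i‖ ≤ B) : L1 S →L[ℝ] W :=
  LinearMap.mkContinuousOfExistsBound
    { toFun := fun μ => ∑' i, μ i • b i
      map_add' := fun μ ν => by
        rw [← (summable_smul_of_bounded hb μ).tsum_add (summable_smul_of_bounded hb ν)]
        simp [add_smul]
      map_smul' := fun c μ => by
        simp only [lp.coeFn_smul, Pi.smul_apply, smul_eq_mul, mul_smul, RingHom.id_apply]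
        exact (summable_smul_of_bounded hb μ).tsum_const_smul c }
    (by
      obtain ⟨B, hB⟩ := hb
      refine ⟨B, fun μ => ?_⟩
      rw [mul_comm, norm_eq_tsum_abs, ← tsum_mul_right]
      exact tsum_of_norm_bounded ((summable_abs μ).mul_right B).hasSum
        (norm_smul_le_of_bounded hB μ))

theorem hasSum_lift (b : S → W) (hb : ∃ B, ∀ i, ‖b i‖ ≤ B) (μ : L1 S) :
    HasSum (fun i => μ i • b i) (lift b hb μ) :=
  (summable_smul_of_bounded hb μ).hasSum

theorem lift_unit (b : S → W) (hb : ∃ B, ∀ i, ‖b i‖ ≤ B) (i : S) : lift b hb (unit i) = b i := by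
  refine (hasSum_lift b hb (unit i)).unique ?_
  convert hasSum_single (f := fun j => unit i j • b j) i fun j hj => by simp [unit_of_ne hj] using 1
  simp [unit_self]

end L1

/-! ### Bounded jump rates and their semigroup -/

/-- The jump rates `r i k` out of the state `i` are nonnegative with sum at most `Λ`. -/
structure BoundedRates {S I : Type*} (r : S → I → ℝ) (Λ : ℝ) : Prop where
  nonneg : ∀ i k, 0 ≤ r i k
  summable : ∀ i, Summable (r i)
  tsum_le : ∀ i, ∑' k, r i k ≤ Λ

section Bounded

variable {S I W : Type*} [NormedAddCommGroup W] [NormedSpace ℝ W]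

/-- The row at `i` of the `Q`-matrix with rate `r i k` for the jump from `i` to `J i k`. -/
def row (r : S → I → ℝ) (J : S → I → S) (i : S) : L1 S :=
  ∑' k, r i k • (unit (J i k) - unit i)

theorem norm_smul_unit_sub_unit_le {c : ℝ} (hc : 0 ≤ c) (i j : S) :
    ‖c • (unit i - unit j)‖ ≤ c * 2 := by
  rw [norm_smul, Real.norm_of_nonneg hc]
  refine mul_le_mul_of_nonneg_left ((norm_sub_le _ _).trans ?_) hc
  rw [norm_unit, norm_unit]; norm_num

theorem hasSum_row {r : S → I → ℝ} (J : S → I → S) {i : S} (h0 : ∀ k, 0 ≤ r i k)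
    (hs : Summable (r i)) :
    HasSum (fun k => r i k • (unit (J i k) - unit i)) (row r J i) :=
  (Summable.of_norm_bounded (hs.mul_right 2)
    fun k => norm_smul_unit_sub_unit_le (h0 k) _ _).hasSum

theorem norm_row_le {r : S → I → ℝ} (J : S → I → S) {i : S} (h0 : ∀ k, 0 ≤ r i k)
    (hs : Summable (r i)) : ‖row r J i‖ ≤ (∑' k, r i k) * 2 := by
  rw [← tsum_mul_right]
  exact tsum_of_norm_bounded (hs.mul_right 2).hasSum
    fun k => norm_smul_unit_sub_unit_le (h0 k) _ _

theorem hasSum_map_row {r : S → I → ℝ} (J : S → I → S) {i : S} (h0 : ∀ k, 0 ≤ r i k)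
    (hs : Summable (r i)) (T : L1 S →L[ℝ] W) :
    HasSum (fun k => r i k • (T (unit (J i k)) - T (unit i))) (T (row r J i)) := by
  simpa using (hasSum_row J h0 hs).mapL T

theorem row_congr {r r' : S → I → ℝ} (J : S → I → S) {i : S} (h : r i = r' i) :
    row r J i = row r' J i := by
  simp [row, h]

variable {r : S → I → ℝ} {Λ : ℝ}

theorem BoundedRates.norm_row_le (h : BoundedRates r Λ) (J : S → I → S) (i : S) :
    ‖row r J i‖ ≤ Λ * 2 :=
  (JumpProcess.norm_row_le J (h.nonneg i) (h.summable i)).trans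
    (mul_le_mul_of_nonneg_right (h.tsum_le i) zero_le_two)

/-- The generator, acting on summable families from the right. -/
def genOp (h : BoundedRates r Λ) (J : S → I → S) : L1 S →L[ℝ] L1 S :=
  lift (row r J) ⟨_, h.norm_row_le J⟩

theorem genOp_unit (h : BoundedRates r Λ) (J : S → I → S) (i : S) :
    genOp h J (unit i) = row r J i := lift_unit _ _ i

/-- The semigroup generated by bounded jump rates. -/
def flow (h : BoundedRates r Λ) (J : S → I → S) (t : ℝ) : L1 S →L[ℝ] L1 S :=
  NormedSpace.exp (t • genOp h J)

variable (h : BoundedRates r Λ) (J : S → I → S)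

theorem flow_zero : flow h J 0 = 1 := by simp [flow]

theorem flow_add (s t : ℝ) : flow h J (s + t) = flow h J s * flow h J t := by
  let := NormedAlgebra.restrictScalars ℚ ℝ (L1 S →L[ℝ] L1 S)
  rw [flow, add_smul]
  exact NormedSpace.exp_add_of_commute (((Commute.refl _).smul_left s).smul_right t)

/-- Backward form: the generator acts on the initial family. At a point mass it only involves one
row of the `Q`-matrix. -/
theorem hasDerivAt_flow (μ : L1 S) (t : ℝ) :
    HasDerivAt (fun t => flow h J t μ) (flow h J t (genOp h J μ)) t := by
  have h1 := (hasDerivAt_exp_smul_const (𝕂 := ℝ) (genOp h J) t).clm_apply (hasDerivAt_const t μ)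
  simpa [flow] using h1

/-- Forward form: the generator acts last, so a functional that annihilates its range is constant
along the flow. -/
theorem hasDerivAt_flow' (μ : L1 S) (t : ℝ) :
    HasDerivAt (fun t => flow h J t μ) (genOp h J (flow h J t μ)) t := by
  have h1 := (hasDerivAt_exp_smul_const' (𝕂 := ℝ) (genOp h J) t).clm_apply (hasDerivAt_const t μ)
  simpa [flow] using h1

theorem continuous_flow (μ : L1 S) : Continuous fun t => flow h J t μ :=
  continuous_iff_continuousAt.2 fun t => (hasDerivAt_flow h J μ t).continuousAt

/-- A functional that no jump changes is invariant under the flow. -/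
theorem map_flow_of_invariant (T : L1 S →L[ℝ] W)
    (hT : ∀ i k, r i k ≠ 0 → T (unit (J i k)) = T (unit i)) (t : ℝ) (μ : L1 S) :
    T (flow h J t μ) = T μ := by
  have h0 : T ∘L genOp h J = 0 := by
    refine ext_unit fun i => ?_
    rw [ContinuousLinearMap.comp_apply, genOp_unit]
    refine (hasSum_map_row J (h.nonneg i) (h.summable i) T).unique ?_
    convert! hasSum_zero using 2 with k
    by_cases hk : r i k = 0
    · simp [hk]
    · simp [hT i k hk]
  have hd : ∀ s, HasDerivAt (fun s => T (flow h J s μ)) 0 s := fun s => by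
    have h1 := T.hasFDerivAt.comp_hasDerivAt s (hasDerivAt_flow' h J μ s)
    have h2 : T (genOp h J (flow h J s μ)) = 0 := DFunLike.congr_fun h0 (flow h J s μ)
    rw [h2] at h1
    exact h1
  have h3 := is_const_of_deriv_eq_zero (fun s => (hd s).differentiableAt) (fun s => (hd s).deriv) t 0
  simpa [flow_zero] using h3

/-- The transition operator of the uniformized discrete-time chain. -/
def stepOp : L1 S →L[ℝ] L1 S := 1 + Λ⁻¹ • genOp h J

theorem stepOp_unit (i : S) : stepOp h J (unit i) = unit i + Λ⁻¹ • row r J i := by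
  simp [stepOp, genOp_unit]

/-- Uniformization: `t • Q = -(t * Λ) + (t * Λ) • (1 + Λ⁻¹ • Q)` with commuting summands, so the
exponential is a Poisson mixture of powers of `stepOp`. -/
theorem hasSum_flow (hΛ : Λ ≠ 0) (t : ℝ) (μ : L1 S) :
    HasSum (fun n : ℕ => (Real.exp (-(t * Λ)) * ((t * Λ) ^ n / n.factorial)) •
      (stepOp h J ^ n) μ) (flow h J t μ) := by
  have e : t • genOp h J = algebraMap ℝ _ (-(t * Λ)) + (t * Λ) • stepOp h J := by
    rw [stepOp, Algebra.algebraMap_eq_smul_one, smul_add, smul_smul, mul_assoc, mul_inv_cancel₀ hΛ,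
      mul_one, neg_smul, neg_add_cancel_left]
  let := NormedAlgebra.restrictScalars ℚ ℝ (L1 S →L[ℝ] L1 S)
  have e2 : flow h J t = Real.exp (-(t * Λ)) • NormedSpace.exp ((t * Λ) • stepOp h J) := by
    rw [flow, e, NormedSpace.exp_add_of_commute (Algebra.commutes _ _),
      ← NormedSpace.algebraMap_exp_comm, Algebra.algebraMap_eq_smul_one, smul_mul_assoc, one_mul,
      Real.exp_eq_exp_ℝ]
  have h1 := NormedSpace.exp_series_hasSum_exp' (𝕂 := ℝ) ((t * Λ) • stepOp h J)
  have h2 := (h1.const_smul (Real.exp (-(t * Λ)))).mapL (ContinuousLinearMap.apply ℝ (L1 S) μ)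
  rw [← e2] at h2
  convert! h2 using 2 with n
  simp [smul_pow, smul_smul, div_eq_inv_mul]

/-! ### Positivity of the flow. -/

theorem row_apply_nonneg {r : S → I → ℝ} (J : S → I → S) {i j : S} (h0 : ∀ k, 0 ≤ r i k)
    (hs : Summable (r i)) (hij : j ≠ i) : 0 ≤ row r J i j := by
  have h1 := hasSum_map_row J h0 hs (lp.evalCLM ℝ (fun _ : S => ℝ) 1 j)
  refine h1.nonneg fun k => mul_nonneg (h0 k) ?_
  change 0 ≤ unit (J i k) j - unit i j
  rw [unit_of_ne hij, sub_zero, unit_apply]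
  split_ifs <;> norm_num

theorem le_row_apply_self {r : S → I → ℝ} (J : S → I → S) {i : S} (h0 : ∀ k, 0 ≤ r i k)
    (hs : Summable (r i)) : -∑' k, r i k ≤ row r J i i := by
  have h1 := hasSum_map_row J h0 hs (lp.evalCLM ℝ (fun _ : S => ℝ) 1 i)
  refine hasSum_le (fun k => ?_) hs.hasSum.neg h1
  change -r i k ≤ r i k * (unit (J i k) i - unit i i)
  have : 0 ≤ unit (J i k) i := by rw [unit_apply]; split_ifs <;> norm_num
  rw [unit_self]
  nlinarith [h0 k]

theorem map_apply_nonneg {T : L1 S →L[ℝ] L1 S} (hT : ∀ i j, 0 ≤ T (unit i) j) {μ : L1 S}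
    (hμ : ∀ i, 0 ≤ μ i) (j : S) : 0 ≤ T μ j := by
  have h1 := hasSum_map (lp.evalCLM ℝ (fun _ : S => ℝ) 1 j ∘L T) μ
  exact h1.nonneg fun i => mul_nonneg (hμ i) (hT i j)

/-- Only the diagonal entry matters: the total rate out of `i` is at most `Λ`, so the diagonal of
the `Q`-matrix is at least `-Λ`. -/
theorem stepOp_unit_nonneg (hΛ : 0 < Λ) (i j : S) : 0 ≤ stepOp h J (unit i) j := by
  rw [stepOp_unit]
  change 0 ≤ unit i j + Λ⁻¹ * row r J i j
  by_cases hij : j = i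
  · subst hij
    have h1 := le_row_apply_self J (h.nonneg j) (h.summable j)
    have h2 := h.tsum_le j
    rw [unit_self, ← div_eq_inv_mul]
    have : -1 ≤ row r J j j / Λ := by rw [le_div_iff₀ hΛ]; linarith
    linarith
  · rw [unit_of_ne hij, zero_add]
    exact mul_nonneg (inv_nonneg.2 hΛ.le) (row_apply_nonneg J (h.nonneg i) (h.summable i) hij)

theorem flow_unit_nonneg (hΛ : 0 < Λ) {t : ℝ} (ht : 0 ≤ t) (i j : S) :
    0 ≤ flow h J t (unit i) j := by
  have h1 := (hasSum_flow h J hΛ.ne' t (unit i)).mapL (lp.evalCLM ℝ (fun _ : S => ℝ) 1 j)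
  have h2 : ∀ n : ℕ, ∀ j, 0 ≤ (stepOp h J ^ n) (unit i) j := by
    intro n
    induction n with
    | zero => intro j; simp [unit_apply]; split_ifs <;> norm_num
    | succ n ih =>
      intro j
      rw [pow_succ']
      exact map_apply_nonneg (stepOp_unit_nonneg h J hΛ) ih j
  refine h1.nonneg fun n => ?_
  exact mul_nonneg (by positivity) (h2 n j)

end Bounded

end JumpProcess

end

noncomputable section

namespace JumpProcess

open Filter

/-! ### Uniqueness of transition functions with bounded rates on a closed class -/

/-- Scheffé's lemma for families of sum zero that are nonnegative away from one index. -/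
theorem tendsto_tsum_abs_sub {α S : Type*} {l : Filter α} {A : α → S → ℝ} {b : S → ℝ} (i : S)
    (hb : HasSum b 0) (hA : ∀ᶠ h in l, HasSum (A h) 0)
    (hnn : ∀ᶠ h in l, ∀ k, k ≠ i → 0 ≤ A h k)
    (hlim : ∀ k, Tendsto (fun h => A h k) l (𝓝 (b k))) :
    Tendsto (fun h => ∑' k, |A h k - b k|) l (𝓝 0) := by
  classical
  -- Both families have sum zero, so the `ℓ¹` distance is twice the sum of the negative parts of `A
  -- h - b`. These are dominated by `|b k|` away from `i`, and by `1` at `i` once `A h i` is close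
  -- to `b i`.
  have habs : ∀ x : ℝ, |x| = x + 2 * max (-x) 0 := fun x => by
    rcases le_total 0 x with hx | hx
    · rw [abs_of_nonneg hx, max_eq_right (by linarith)]; ring
    · rw [abs_of_nonpos hx, max_eq_left (by linarith)]; ring
  have hpos : Tendsto (fun h => ∑' k, max (-(A h k - b k)) 0) l (𝓝 (∑' _ : S, (0 : ℝ))) := by
    refine tendsto_tsum_of_dominated_convergence (bound := fun k => |b k| + if k = i then 1 else 0)
      (hb.summable.abs.add (hasSum_ite_eq i (1 : ℝ)).summable) (fun k => ?_) ?_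
    · have h1 : Tendsto (fun h => max (-(A h k - b k)) 0) l (𝓝 (max (-(b k - b k)) 0)) :=
        (((hlim k).sub_const _).neg).max tendsto_const_nhds
      simpa using h1
    · have h1 : ∀ᶠ h in l, |A h i - b i| < 1 := by
        have h2 := ((hlim i).sub_const (b i)).abs
        rw [sub_self, abs_zero] at h2
        exact h2.eventually_lt_const one_pos
      filter_upwards [hnn, h1] with h h2 h3 k
      rw [Real.norm_of_nonneg (le_max_right _ _)]
      refine max_le ?_ (add_nonneg (abs_nonneg _) (by split_ifs <;> norm_num))
      by_cases hk : k = i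
      · subst hk
        rw [if_pos rfl]
        linarith [neg_le_abs (A h k - b k), abs_nonneg (b k)]
      · rw [if_neg hk]
        linarith [h2 k hk, le_abs_self (b k)]
  rw [tsum_zero] at hpos
  have h2 := hpos.const_mul 2
  rw [mul_zero] at h2
  refine h2.congr' ?_
  filter_upwards [hA] with h hh
  have h3 : HasSum (fun k => A h k - b k) 0 := by simpa using hh.sub hb
  have h4 : Summable fun k => max (-(A h k - b k)) 0 :=
    Summable.of_nonneg_of_le (fun k => le_max_right _ _)
      (fun k => max_le (neg_le_abs _) (abs_nonneg _)) h3.summable.abs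
  simp_rw [habs]
  rw [h3.summable.tsum_add (h4.mul_left 2), h3.tsum_eq, zero_add, tsum_mul_left]

end JumpProcess

namespace MassMigration

open Filter JumpProcess

section Transition

variable {S : Type*} {q : S → S → ℝ} {P : ℝ≥0 → S → S → ℝ}

theorem IsTransitionFunction.le_one (hP : IsTransitionFunction q P) (t : ℝ≥0) (i j : S) :
    P t i j ≤ 1 :=
  le_hasSum (hP.hasSum_one t i) j fun k _ => hP.nonneg t i k

theorem IsTransitionFunction.zero_of_ne (hP : IsTransitionFunction q P) {i j : S} (h : j ≠ i) :
    P 0 i j = 0 := by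
  classical
  have h1 := sum_le_hasSum {i, j} (fun k _ => hP.nonneg 0 i k) (hP.hasSum_one 0 i)
  rw [Finset.sum_pair h.symm, hP.zero_self] at h1
  linarith [hP.nonneg 0 i j]

/-- Splitting at time `h` gives `P (t + h) i j = P h i i * P t i j` plus a remainder in `[0, 1 - P h
i i]`. The upper bound comes from the same splitting for the complementary probability `1 - P t k
j`. -/
theorem IsTransitionFunction.abs_sub_le (hP : IsTransitionFunction q P) (t h : ℝ≥0) (i j : S) :
    |P (t + h) i j - P t i j| ≤ 1 - P h i i := by
  have h1 := hP.chapman_kolmogorov h t i j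
  rw [add_comm h t] at h1
  have h2 : HasSum (fun k => P h i k * (1 - P t k j)) (1 - P (t + h) i j) := by
    convert! (hP.hasSum_one h i).sub h1 using 2; ring
  have h3 := le_hasSum h1 i fun k _ => mul_nonneg (hP.nonneg h i k) (hP.nonneg t k j)
  have h4 := le_hasSum h2 i fun k _ =>
    mul_nonneg (hP.nonneg h i k) (sub_nonneg.2 (hP.le_one t k j))
  rw [abs_le]
  constructor <;> nlinarith [hP.le_one h i i, hP.nonneg t i j, hP.le_one t i j]

/-- A finite derivative at `0` forces continuity there; with the preceding estimate this yields
continuity at all times. -/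
theorem IsTransitionFunction.tendsto_self (hP : IsTransitionFunction q P) (i : S) :
    Tendsto (fun h => P h i i) (𝓝 0) (𝓝 1) := by
  have h1 : Tendsto (fun h : ℝ≥0 => (P h i i - P 0 i i) / h * h + 1) (𝓝[>] 0) (𝓝 (q i i * 0 + 1)) :=
    ((hP.rate i i).mul ((NNReal.tendsto_coe.2 tendsto_id).mono_left nhdsWithin_le_nhds)).add_const 1
  have h2 : Tendsto (fun h => P h i i) (𝓝[>] 0) (𝓝 1) := by
    rw [mul_zero, zero_add] at h1
    refine h1.congr' ?_
    filter_upwards [self_mem_nhdsWithin] with h hh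
    rw [div_mul_cancel₀ _ (NNReal.coe_ne_zero.2 (ne_of_gt hh)), hP.zero_self, sub_add_cancel]
  have h3 : ContinuousWithinAt (fun h => P h i i) (Set.Ioi 0) 0 := by
    rw [ContinuousWithinAt, hP.zero_self]; exact h2
  have h4 := continuousWithinAt_insert_self.2 h3
  have h5 : insert (0 : ℝ≥0) (Set.Ioi 0) = Set.univ := by
    ext x; simp
  rw [h5, continuousWithinAt_univ, ContinuousAt, hP.zero_self] at h4
  exact h4

theorem IsTransitionFunction.abs_sub_le_nndist (hP : IsTransitionFunction q P) (s t : ℝ≥0)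
    (i j : S) : |P s i j - P t i j| ≤ 1 - P (nndist s t) i i := by
  rcases le_total t s with h | h
  · have := hP.abs_sub_le t (s - t) i j
    rw [add_tsub_cancel_of_le h] at this
    simpa [NNReal.nndist_eq, tsub_eq_zero_of_le h] using this
  · have := hP.abs_sub_le s (t - s) i j
    rw [add_tsub_cancel_of_le h, abs_sub_comm] at this
    simpa [NNReal.nndist_eq, tsub_eq_zero_of_le h] using this

theorem IsTransitionFunction.continuous (hP : IsTransitionFunction q P) (i j : S) :
    Continuous fun t => P t i j := by
  refine continuous_iff_continuousAt.2 fun t => ?_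
  rw [ContinuousAt, tendsto_iff_norm_sub_tendsto_zero]
  have h1 : Tendsto (fun s => 1 - P (nndist s t) i i) (𝓝 t) (𝓝 (1 - 1)) := by
    refine tendsto_const_nhds.sub ((hP.tendsto_self i).comp ?_)
    have : Continuous fun s => nndist s t := by fun_prop
    simpa using this.tendsto t
  rw [sub_self] at h1
  exact squeeze_zero (fun _ => norm_nonneg _) (fun s => hP.abs_sub_le_nndist s t i j) h1

/-- The rates are given entrywise. Upgrading the convergence to `ℓ¹` permits exchanging the limit
with the Chapman–Kolmogorov sum in the backward equation. -/
theorem IsTransitionFunction.tendsto_rates (hP : IsTransitionFunction q P) {i : S}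
    (hq : HasSum (q i) 0) :
    Tendsto (fun h : ℝ≥0 => ∑' k, |(P h i k - P 0 i k) / h - q i k|) (𝓝[>] 0) (𝓝 0) := by
  refine tendsto_tsum_abs_sub i hq (Eventually.of_forall fun h => ?_)
    (Eventually.of_forall fun h k hk => ?_) fun k => hP.rate i k
  · simpa using ((hP.hasSum_one h i).sub (hP.hasSum_one 0 i)).div_const (h : ℝ)
  · rw [hP.zero_of_ne hk, sub_zero]
    exact div_nonneg (hP.nonneg _ _ _) h.2

theorem IsTransitionFunction.summable_mul (hP : IsTransitionFunction q P) {c : S → ℝ}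
    (hc : Summable c) (t : ℝ≥0) (j : S) : Summable fun k => c k * P t k j :=
  Summable.of_norm_bounded hc.abs fun k => by
    rw [norm_mul, Real.norm_eq_abs, Real.norm_of_nonneg (hP.nonneg t k j)]
    exact mul_le_of_le_one_right (abs_nonneg _) (hP.le_one t k j)

theorem IsTransitionFunction.abs_slope_sub_le (hP : IsTransitionFunction q P) {i : S}
    (hq : HasSum (q i) 0) (t h : ℝ≥0) (j : S) :
    |(P (t + h) i j - P t i j) / h - ∑' k, q i k * P t k j| ≤
      ∑' k, |(P h i k - P 0 i k) / h - q i k| := by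
  have h1 : HasSum (fun k => (P h i k - P 0 i k) / h * P t k j) ((P (t + h) i j - P t i j) / h) := by
    have h2 := ((hP.chapman_kolmogorov h t i j).sub (hP.chapman_kolmogorov 0 t i j)).div_const
      (h : ℝ)
    rw [add_comm h t, zero_add] at h2
    convert! h2 using 2; ring
  have h2 := h1.sub (hP.summable_mul hq.summable t j).hasSum
  rw [← h2.tsum_eq, ← Real.norm_eq_abs]
  have h3 : Summable fun k => |(P h i k - P 0 i k) / h - q i k| :=
    ((((hP.hasSum_one h i).sub (hP.hasSum_one 0 i)).div_const (h : ℝ)).sub hq).summable.abs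
  refine tsum_of_norm_bounded h3.hasSum fun k => ?_
  rw [← sub_mul, norm_mul, Real.norm_eq_abs, Real.norm_of_nonneg (hP.nonneg t k j)]
  exact mul_le_of_le_one_right (abs_nonneg _) (hP.le_one t k j)

/-- The backward equation, for the right derivative. -/
theorem IsTransitionFunction.hasDerivWithinAt (hP : IsTransitionFunction q P) {i : S}
    (hq : HasSum (q i) 0) (j : S) {t : ℝ} (ht : 0 ≤ t) :
    HasDerivWithinAt (fun s : ℝ => P s.toNNReal i j) (∑' k, q i k * P t.toNNReal k j)
      (Set.Ici t) t := by
  rw [← hasDerivWithinAt_Ioi_iff_Ici, hasDerivWithinAt_iff_tendsto_slope' Set.self_notMem_Ioi,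
    tendsto_iff_norm_sub_tendsto_zero]
  have h1 : Tendsto (fun s : ℝ => (s - t).toNNReal) (𝓝[>] t) (𝓝[>] 0) := by
    refine tendsto_nhdsWithin_iff.2 ⟨?_, ?_⟩
    · have : Continuous fun s : ℝ => (s - t).toNNReal := by fun_prop
      simpa using (this.tendsto t).mono_left nhdsWithin_le_nhds
    · filter_upwards [self_mem_nhdsWithin] with s hs
      exact Real.toNNReal_pos.2 (sub_pos.2 hs)
  refine squeeze_zero' (Eventually.of_forall fun _ => norm_nonneg _) ?_
    ((hP.tendsto_rates hq).comp h1)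
  filter_upwards [self_mem_nhdsWithin] with s hs
  have h2 := hP.abs_slope_sub_le hq t.toNNReal (s - t).toNNReal j
  have h3 : 0 ≤ s - t := sub_nonneg.2 (le_of_lt hs)
  rw [← Real.toNNReal_add ht h3, add_sub_cancel] at h2
  rw [Real.norm_eq_abs, slope_def_field]
  rw [Real.coe_toNNReal _ h3] at h2
  simpa only [Function.comp_apply, Real.coe_toNNReal _ h3] using h2

/-- Two transition functions whose rates agree on a closed class of states with bounded rates agree
on this class. -/
theorem IsTransitionFunction.eq_of_rates_eqOn {q' : S → S → ℝ} {P' : ℝ≥0 → S → S → ℝ}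
    (hP : IsTransitionFunction q P) (hP' : IsTransitionFunction q' P') (D : Set S) (B : ℝ)
    (heq : ∀ i ∈ D, q i = q' i) (hq : ∀ i ∈ D, HasSum (q i) 0)
    (hB : ∀ i ∈ D, ∑' k, |q i k| ≤ B) (hD : ∀ i ∈ D, ∀ j, j ∉ D → q i j = 0)
    (t : ℝ≥0) {i : S} (hi : i ∈ D) (j : S) : P t i j = P' t i j := by
  have hB0 : 0 ≤ B := (tsum_nonneg fun k => abs_nonneg (q i k)).trans (hB i hi)
  -- Picard iteration: the difference of two probabilities is at most `1`, and each use of the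
  -- backward equation, which never leaves `D`, integrates the previous bound once more. Letting `n`
  -- tend to infinity gives equality.
  have key : ∀ n : ℕ, ∀ i ∈ D, ∀ t : ℝ, 0 ≤ t →
      ‖P t.toNNReal i j - P' t.toNNReal i j‖ ≤ (B * t) ^ n / n.factorial := by
    intro n
    induction n with
    | zero =>
      intro i _ t _
      rw [pow_zero, Nat.factorial_zero, Nat.cast_one, div_one, Real.norm_eq_abs, abs_le]
      constructor <;> linarith [hP.nonneg t.toNNReal i j, hP.le_one t.toNNReal i j,
        hP'.nonneg t.toNNReal i j, hP'.le_one t.toNNReal i j]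
    | succ n ih =>
      intro i hi T hT
      have hcont : Continuous fun s : ℝ => P s.toNNReal i j - P' s.toNNReal i j :=
        ((hP.continuous i j).comp continuous_real_toNNReal).sub
          ((hP'.continuous i j).comp continuous_real_toNNReal)
      have hq' : HasSum (q' i) 0 := heq i hi ▸ hq i hi
      -- Only right derivatives are known, which together with continuity suffices for this form of
      -- the mean value inequality.
      refine image_norm_le_of_norm_deriv_right_le_deriv_boundary
        (f := fun s : ℝ => P s.toNNReal i j - P' s.toNNReal i j) (a := 0) (b := T)
        (B := fun s => (B * s) ^ (n + 1) / (n + 1).factorial)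
        (B' := fun s => B * ((B * s) ^ n / n.factorial)) hcont.continuousOn
        (fun s hs => (hP.hasDerivWithinAt (hq i hi) j hs.1).sub (hP'.hasDerivWithinAt hq' j hs.1))
        ?_ (fun s => ?_) (fun s hs => ?_) ⟨hT, le_rfl⟩
      · have : P 0 i j = P' 0 i j := by
          by_cases hij : j = i
          · rw [hij, hP.zero_self, hP'.zero_self]
          · rw [hP.zero_of_ne hij, hP'.zero_of_ne hij]
        simp [this]
      · have h1 := (((hasDerivAt_id s).const_mul B).pow (n + 1)).div_const ((n + 1).factorial : ℝ)
        convert! h1 using 1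
        rw [Nat.factorial_succ]
        push_cast
        field_simp
        simp
      · rw [← heq i hi, ← (hP.summable_mul (hq i hi).summable _ j).tsum_sub
          (hP'.summable_mul (hq i hi).summable _ j)]
        refine (tsum_of_norm_bounded ((hq i hi).summable.abs.mul_right
          ((B * s) ^ n / n.factorial)).hasSum fun k => ?_).trans ?_
        · rw [← mul_sub, norm_mul, Real.norm_eq_abs]
          by_cases hk : k ∈ D
          · exact mul_le_mul_of_nonneg_left (ih k hk s hs.1) (abs_nonneg _)
          · simp [hD i hi k hk]
        · rw [tsum_mul_right]
          exact mul_le_mul_of_nonneg_right (hB i hi)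
            (div_nonneg (pow_nonneg (mul_nonneg hB0 hs.1) _) (Nat.cast_nonneg _))
  have h1 : ‖P t i j - P' t i j‖ ≤ 0 :=
    ge_of_tendsto' (FloorSemiring.tendsto_pow_div_factorial_atTop (B * (t : ℝ))) fun n => by
      simpa using key n i hi t t.2
  exact sub_eq_zero.1 (norm_le_zero_iff.1 h1)

end Transition

end MassMigration

end

noncomputable section

namespace JumpProcess

open Filter MassMigration

/-! ### The transition function of bounded jump rates -/

section Bounded

variable {S I : Type*} {r : S → I → ℝ} {Λ : ℝ}

/-- The total mass of a summable family. -/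
def mass (S : Type*) : L1 S →L[ℝ] ℝ := lift (fun _ => 1) ⟨1, fun _ => by simp⟩

theorem hasSum_mass (μ : L1 S) : HasSum (fun i => μ i) (mass S μ) := by
  have h := hasSum_lift (fun _ : S => (1 : ℝ)) ⟨1, fun _ => by simp⟩ μ
  simp only [smul_eq_mul, mul_one] at h
  exact h

theorem mass_unit (i : S) : mass S (unit i) = 1 := lift_unit _ _ i

/-- The coordinate functional at `j`. -/
abbrev coord (j : S) : L1 S →L[ℝ] ℝ := lp.evalCLM ℝ (fun _ : S => ℝ) 1 j

theorem hasSum_row_zero (J : S → I → S) {i : S} (h0 : ∀ k, 0 ≤ r i k) (hs : Summable (r i)) :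
    HasSum (fun j => row r J i j) 0 := by
  have h1 := hasSum_map_row J h0 hs (mass S)
  simp only [mass_unit, sub_self, smul_zero] at h1
  rw [hasSum_zero.unique h1]
  exact hasSum_mass _

theorem row_apply_eq_zero (J : S → I → S) {i j : S} (h0 : ∀ k, 0 ≤ r i k) (hs : Summable (r i))
    (hij : j ≠ i) (hj : ∀ k, r i k ≠ 0 → J i k ≠ j) : row r J i j = 0 := by
  refine (hasSum_map_row J h0 hs (coord j)).unique ?_
  convert! hasSum_zero using 2 with k
  by_cases hk : r i k = 0
  · simp [hk]
  · change r i k * (unit (J i k) j - unit i j) = 0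
    rw [unit_of_ne hij, unit_of_ne (hj k hk).symm, sub_zero, mul_zero]

/-- Total mass is a functional that no jump changes, so the transition function is honest; the rates
are the backward derivative at `0`. -/
theorem isTransitionFunction_flow (h : BoundedRates r Λ) (hΛ : 0 < Λ) (J : S → I → S) :
    IsTransitionFunction (fun i j => row r J i j) (fun t i j => flow h J t (unit i) j) where
  nonneg t i j := flow_unit_nonneg h J hΛ t.2 i j
  hasSum_one t i := by
    have h1 := map_flow_of_invariant h J (mass S) (fun i k _ => by simp [mass_unit]) t (unit i)
    have h2 := hasSum_mass (flow h J t (unit i))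
    rwa [h1, mass_unit] at h2
  zero_self i := by simp [flow_zero, unit_self]
  chapman_kolmogorov s t i j := by
    have h1 := hasSum_map (coord j ∘L flow h J t) (flow h J s (unit i))
    rw [add_comm, NNReal.coe_add, flow_add]
    exact h1
  rate i j := by
    have h1 := (coord j).hasFDerivAt.comp_hasDerivAt 0 (hasDerivAt_flow h J (unit i) 0)
    have h2 := h1.tendsto_slope_zero_right
    rw [flow_zero, genOp_unit] at h2
    have h3 : Tendsto (fun h : ℝ≥0 => (h : ℝ)) (𝓝[>] 0) (𝓝[>] 0) := by
      refine tendsto_nhdsWithin_iff.2 ⟨?_, ?_⟩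
      · exact (NNReal.continuous_coe.tendsto 0).mono_left nhdsWithin_le_nhds
      · filter_upwards [self_mem_nhdsWithin] with s hs
        exact NNReal.coe_pos.2 hs
    convert! h2.comp h3 using 2 with t
    rw [div_eq_inv_mul, Function.comp_apply, zero_add]
    rfl

end Bounded

/-! ### Comparison of two states under one step of the uniformized chain -/

/-- The basic coupling of two families of jumps. -/
theorem step_sub_step_le {I : Type*} {r s u v ℓ : I → ℝ} {x y K W Λ c : ℝ} (hΛ : 0 < Λ)
    (hK : 0 ≤ K) (hr : ∀ k, 0 ≤ r k) (hs : ∀ k, 0 ≤ s k) (hrs : Summable r) (hss : Summable s)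
    (hsum : ∑' k, r k + ∑' k, s k ≤ Λ) (hxy : x - y ≤ K * W)
    (huv : ∀ k, r k ≠ 0 → s k ≠ 0 → u k - v k ≤ K * W)
    (huy : ∀ k, r k ≠ 0 → u k - y ≤ K * (W + ℓ k))
    (hxv : ∀ k, s k ≠ 0 → x - v k ≤ K * (W + ℓ k))
    (hℓ : Summable fun k => |r k - s k| * ℓ k) (hc : ∑' k, |r k - s k| * ℓ k ≤ c * W)
    {R R' : ℝ} (hR : HasSum (fun k => r k * (u k - x)) R)
    (hR' : HasSum (fun k => s k * (v k - y)) R') :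
    (x + Λ⁻¹ * R) - (y + Λ⁻¹ * R') ≤ K * (1 + c / Λ) * W := by
  have hmax : Summable fun k => max (r k) (s k) :=
    Summable.of_nonneg_of_le (fun k => le_max_of_le_left (hr k))
      (fun k => max_le (le_add_of_nonneg_right (hs k)) (le_add_of_nonneg_left (hr k)))
      (hrs.add hss)
  have hm : ∑' k, max (r k) (s k) ≤ Λ := by
    refine le_trans ?_ hsum
    rw [← hrs.tsum_add hss]
    exact hmax.tsum_le_tsum (fun k => max_le (le_add_of_nonneg_right (hs k))
      (le_add_of_nonneg_left (hr k))) (hrs.add hss)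
  -- If `s k ≤ r k`, the left side equals `s k * (u k - v k) + (r k - s k) * (u k - y)`: a joint
  -- jump at the smaller rate and a lone jump at the excess rate. The other case is symmetric.
  have hpt : ∀ k, r k * (u k - x) - s k * (v k - y) + max (r k) (s k) * (x - y) ≤
      K * (max (r k) (s k) * W + |r k - s k| * ℓ k) := by
    intro k
    rcases le_total (s k) (r k) with h | h
    · rw [max_eq_left h, abs_of_nonneg (sub_nonneg.2 h)]
      have h1 : s k * (u k - v k) ≤ s k * (K * W) := by
        by_cases h2 : s k = 0
        · simp [h2]
        · exact mul_le_mul_of_nonneg_left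
            (huv k (((hs k).lt_of_ne' h2).trans_le h).ne' h2) (hs k)
      have h3 : (r k - s k) * (u k - y) ≤ (r k - s k) * (K * (W + ℓ k)) := by
        by_cases h2 : r k = 0
        · have : s k = 0 := le_antisymm (h2 ▸ h) (hs k)
          simp [h2, this]
        · exact mul_le_mul_of_nonneg_left (huy k h2) (sub_nonneg.2 h)
      linarith
    · rw [max_eq_right h, abs_of_nonpos (sub_nonpos.2 h)]
      have h1 : r k * (u k - v k) ≤ r k * (K * W) := by
        by_cases h2 : r k = 0
        · simp [h2]
        · exact mul_le_mul_of_nonneg_left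
            (huv k h2 (((hr k).lt_of_ne' h2).trans_le h).ne') (hr k)
      have h3 : (s k - r k) * (x - v k) ≤ (s k - r k) * (K * (W + ℓ k)) := by
        by_cases h2 : s k = 0
        · have : r k = 0 := le_antisymm (h2 ▸ h) (hr k)
          simp [h2, this]
        · exact mul_le_mul_of_nonneg_left (hxv k h2) (sub_nonneg.2 h)
      linarith
  have h1 := hasSum_le hpt ((hR.sub hR').add (hmax.hasSum.mul_right (x - y)))
    (((hmax.hasSum.mul_right W).add hℓ.hasSum).mul_left K)
  set m := ∑' k, max (r k) (s k)
  -- With the remaining rate `Λ - m` neither state moves; this rate is nonnegative because `Λ`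
  -- bounds the sum of both total rates.
  have h2 := mul_le_mul_of_nonneg_left hxy (sub_nonneg.2 hm)
  have h3 := mul_le_mul_of_nonneg_left hc hK
  have h4 : Λ * (x - y) + (R - R') ≤ K * (Λ + c) * W := by linarith
  have h5 : (x + Λ⁻¹ * R) - (y + Λ⁻¹ * R') = (Λ * (x - y) + (R - R')) / Λ := by
    field_simp; ring
  have h6 : K * (1 + c / Λ) * W = (K * (Λ + c) * W) / Λ := by field_simp
  rw [h5, h6]
  exact div_le_div_of_nonneg_right h4 hΛ.le

/-! ### Jump rates that are bounded on the levels of a conserved quantity -/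

/-- The jumps conserve `d`, and the total jump rate out of `i` is at most `L * d i`. -/
structure GradedRates {S I : Type*} (r : S → I → ℝ) (J : S → I → S) (d : S → ℕ) (L : ℝ) :
    Prop where
  pos : 0 < L
  nonneg : ∀ i k, 0 ≤ r i k
  summable : ∀ i, Summable (r i)
  tsum_le : ∀ i, ∑' k, r i k ≤ L * d i
  conserved : ∀ i k, r i k ≠ 0 → d (J i k) = d i

/-- The rates `r`, set to zero on the states of level greater than `N`. -/
def truncRate {S I : Type*} (r : S → I → ℝ) (d : S → ℕ) (N : ℕ) (i : S) (k : I) : ℝ :=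
  if d i ≤ N then r i k else 0

section Graded

variable {S I : Type*} {r : S → I → ℝ} {J : S → I → S} {d : S → ℕ} {L : ℝ}

theorem truncRate_of_le {i : S} {N : ℕ} (hi : d i ≤ N) : truncRate r d N i = r i := by
  ext k; simp [truncRate, hi]

theorem truncRate_of_not_le {i : S} {N : ℕ} (hi : ¬ d i ≤ N) : truncRate r d N i = 0 := by
  ext k; simp [truncRate, hi]

variable (h : GradedRates r J d L)
include h

/-- In `2 * L * N + 1`, the factor `2` leaves room for the jumps of two coupled states, and the `1`
makes the uniformization rate positive even for `N = 0`. -/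
theorem GradedRates.bounded (N : ℕ) : BoundedRates (truncRate r d N) (2 * L * N + 1) where
  nonneg i k := by
    unfold truncRate
    split_ifs
    exacts [h.nonneg i k, le_rfl]
  summable i := by
    by_cases hi : d i ≤ N
    · rw [truncRate_of_le hi]; exact h.summable i
    · rw [truncRate_of_not_le hi]; exact summable_zero
  tsum_le i := by
    have h1 : 0 ≤ L * N := mul_nonneg h.pos.le N.cast_nonneg
    by_cases hi : d i ≤ N
    · rw [truncRate_of_le hi]
      have h2 : L * d i ≤ L * N := mul_le_mul_of_nonneg_left (Nat.cast_le.2 hi) h.pos.le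
      linarith [h.tsum_le i]
    · rw [truncRate_of_not_le hi]
      simp only [Pi.zero_apply, tsum_zero]
      linarith

theorem GradedRates.bound_pos (N : ℕ) : 0 < 2 * L * N + 1 := by
  have := h.pos
  positivity

/-- The flow of the rates truncated at level `N`. -/
def GradedRates.truncFlow (N : ℕ) (t : ℝ) : L1 S →L[ℝ] L1 S := flow (h.bounded N) J t

theorem GradedRates.truncFlow_add (N : ℕ) (s t : ℝ) :
    h.truncFlow N (s + t) = h.truncFlow N s * h.truncFlow N t := flow_add _ _ _ _

theorem GradedRates.isTransitionFunction_truncFlow (N : ℕ) :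
    IsTransitionFunction (fun i j => row (truncRate r d N) J i j)
      (fun t i j => h.truncFlow N t (unit i) j) :=
  isTransitionFunction_flow (h.bounded N) (h.bound_pos N) J

theorem GradedRates.conserved_trunc (N : ℕ) (i : S) (k : I) (hk : truncRate r d N i k ≠ 0) :
    d (J i k) = d i := by
  refine h.conserved i k ?_
  unfold truncRate at hk
  split_ifs at hk
  exacts [hk, absurd rfl hk]

/-- The law at time `t` of the chain started at `i`. -/
def GradedRates.law (t : ℝ≥0) (i : S) : L1 S := h.truncFlow (d i) t (unit i)

/-- The level of `i` is a closed class on which truncation at `N` and at `d i` both leave the rates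
unchanged, so uniqueness applies. -/
theorem GradedRates.truncFlow_unit {N : ℕ} {i : S} (hi : d i ≤ N) (t : ℝ≥0) :
    h.truncFlow N t (unit i) = h.law t i := by
  ext j
  refine (h.isTransitionFunction_truncFlow N).eq_of_rates_eqOn
    (h.isTransitionFunction_truncFlow (d i)) {j | d j = d i} ((2 * L * N + 1) * 2)
    (fun j hj => ?_) (fun j _ => ?_) (fun j _ => ?_) (fun j hj l hl => ?_) t rfl j
  · ext l
    rw [row_congr J (i := j) (r' := truncRate r d (d i))]
    rw [truncRate_of_le (hj.le.trans hi), truncRate_of_le hj.le]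
  · exact hasSum_row_zero J ((h.bounded N).nonneg j) ((h.bounded N).summable j)
  · rw [← norm_eq_tsum_abs]
    exact (h.bounded N).norm_row_le J j
  · refine row_apply_eq_zero J ((h.bounded N).nonneg j) ((h.bounded N).summable j) ?_ fun k hk => ?_
    · rintro rfl; exact hl hj
    · rintro rfl; exact hl ((h.conserved_trunc N j k hk).trans hj)

/-- The mass outside the initial level is invariant under the flow and vanishes at time `0`; its
terms are nonnegative, so each is zero. -/
theorem GradedRates.law_apply_eq_zero (t : ℝ≥0) {i j : S} (hij : d j ≠ d i) :
    h.law t i j = 0 := by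
  classical
  let b : S → ℝ := fun j => if d j = d i then 0 else 1
  have hb : ∃ B, ∀ j, ‖b j‖ ≤ B := ⟨1, fun j => by simp only [b]; split_ifs <;> simp⟩
  have h1 := map_flow_of_invariant (h.bounded (d i)) J (lift b hb)
    (fun l k hk => by simp [lift_unit, b, h.conserved_trunc _ l k hk]) t (unit i)
  have h2 := hasSum_lift b hb (h.law t i)
  rw [GradedRates.law, GradedRates.truncFlow, h1, lift_unit] at h2
  have h3 := le_hasSum h2 j fun k _ => mul_nonneg
    ((h.isTransitionFunction_truncFlow (d i)).nonneg t i k) (by simp only [b]; split_ifs <;> simp)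
  have h4 := (h.isTransitionFunction_truncFlow (d i)).nonneg t i j
  simp only [b, if_neg hij, if_true, smul_eq_mul, mul_one] at h3
  exact le_antisymm h3 h4

/-- For fixed `i` everything is inherited from the truncation at `d i`. In Chapman–Kolmogorov the
intermediate states of other levels carry no mass. -/
theorem GradedRates.isTransitionFunction :
    IsTransitionFunction (fun i j => row r J i j) (fun t i j => h.law t i j) where
  nonneg t i j := (h.isTransitionFunction_truncFlow (d i)).nonneg t i j
  hasSum_one t i := (h.isTransitionFunction_truncFlow (d i)).hasSum_one t i
  zero_self i := (h.isTransitionFunction_truncFlow (d i)).zero_self i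
  chapman_kolmogorov s t i j := by
    convert! (h.isTransitionFunction_truncFlow (d i)).chapman_kolmogorov s t i j using 2 with k
    by_cases hk : d k = d i
    · rw [← h.truncFlow_unit hk.le t]; rfl
    · rw [h.law_apply_eq_zero s hk, zero_mul]
      exact (mul_eq_zero_of_left (h.law_apply_eq_zero s hk) _).symm
  rate i j := by
    have h1 := (h.isTransitionFunction_truncFlow (d i)).rate i j
    rwa [row_congr J (i := i) (truncRate_of_le le_rfl)] at h1

/-! ### Expectations of level-bounded functions. -/

omit h

/-- `f` is bounded on every level of `d`. -/
def LevelBounded (d : S → ℕ) (f : S → ℝ) : Prop := ∀ n, ∃ B, ∀ i, d i ≤ n → |f i| ≤ B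

/-- Here `truncRate` with index type `Unit` serves as a cut-off for functions. -/
theorem LevelBounded.exists_bound {f : S → ℝ} (hf : LevelBounded d f) (N : ℕ) :
    ∃ B, ∀ i, ‖truncRate (fun i (_ : Unit) => f i) d N i ()‖ ≤ B := by
  obtain ⟨B, hB⟩ := hf N
  refine ⟨max B 0, fun i => ?_⟩
  unfold truncRate
  split_ifs with hi
  · exact (hB i hi).trans (le_max_left _ _)
  · simp

/-- Integration of a level-bounded function, set to zero above level `N`. -/
def LevelBounded.pairing {f : S → ℝ} (hf : LevelBounded d f) (N : ℕ) : L1 S →L[ℝ] ℝ :=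
  lift (fun i => truncRate (fun i (_ : Unit) => f i) d N i ()) (hf.exists_bound N)

theorem LevelBounded.pairing_unit {f : S → ℝ} (hf : LevelBounded d f) {N : ℕ} {i : S}
    (hi : d i ≤ N) : hf.pairing N (unit i) = f i := by
  rw [pairing, lift_unit, truncRate_of_le hi]

include h

/-- The expectation of `f` at time `t` for the chain started at `i`. -/
def GradedRates.expect (f : S → ℝ) (t : ℝ≥0) (i : S) : ℝ := ∑' j, h.law t i j * f j

variable {f : S → ℝ} (hf : LevelBounded d f)
include hf

theorem GradedRates.hasSum_pairing {N : ℕ} {i : S} (hi : d i ≤ N) (t : ℝ≥0) :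
    HasSum (fun j => h.law t i j * f j) (hf.pairing N (h.truncFlow N t (unit i))) := by
  rw [h.truncFlow_unit hi]
  convert! hasSum_lift _ (hf.exists_bound N) (h.law t i) using 2 with j
  by_cases hj : d j = d i
  · rw [truncRate_of_le (hj.le.trans hi), smul_eq_mul]
  · rw [h.law_apply_eq_zero t hj, zero_mul, zero_smul]

theorem GradedRates.pairing_truncFlow {N : ℕ} {i : S} (hi : d i ≤ N) (t : ℝ≥0) :
    hf.pairing N (h.truncFlow N t (unit i)) = h.expect f t i :=
  (h.hasSum_pairing hf hi t).tsum_eq.symm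

theorem GradedRates.hasSum_expect (t : ℝ≥0) (i : S) :
    HasSum (fun j => h.law t i j * f j) (h.expect f t i) :=
  (h.hasSum_pairing hf le_rfl t).summable.hasSum

theorem GradedRates.expect_zero (i : S) : h.expect f 0 i = f i := by
  rw [← h.pairing_truncFlow hf le_rfl, truncFlow, NNReal.coe_zero, flow_zero]
  exact hf.pairing_unit le_rfl

theorem GradedRates.hasSum_expect_add (s t : ℝ≥0) (i : S) :
    HasSum (fun k => h.law s i k * h.expect f t k) (h.expect f (s + t) i) := by
  rw [← h.pairing_truncFlow hf le_rfl (s + t), NNReal.coe_add, add_comm, truncFlow_add]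
  have h1 := hasSum_map (hf.pairing (d i) ∘L h.truncFlow (d i) t) (h.law s i)
  refine h1.congr_fun fun k => ?_
  by_cases hk : d k = d i
  · rw [ContinuousLinearMap.comp_apply, h.pairing_truncFlow hf hk.le, smul_eq_mul]
  · rw [h.law_apply_eq_zero s hk, zero_mul, zero_smul]

/-- The integrated backward equation. -/
theorem GradedRates.exists_backward (i : S) : ∃ D : ℝ → ℝ, Continuous D ∧
    (∀ t : ℝ≥0, HasSum (fun k => r i k * (h.expect f t (J i k) - h.expect f t i)) (D t)) ∧
    ∀ t : ℝ≥0, h.expect f t i = f i + ∫ s in (0 : ℝ)..t, D s := by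
  set N := d i
  have hrow : row (truncRate r d N) J i = row r J i := row_congr J (truncRate_of_le le_rfl)
  have hcont : Continuous fun t => hf.pairing N (h.truncFlow N t (row r J i)) :=
    (hf.pairing N).continuous.comp (continuous_flow (h.bounded N) J _)
  -- By the backward form the derivative is the flow of a fixed family, paired with `f`; it is thus
  -- continuous, and its expansion only involves states of the level of `i`.
  refine ⟨fun t => hf.pairing N (h.truncFlow N t (row r J i)), hcont, fun t => ?_, fun t => ?_⟩
  · have h1 := hasSum_map_row J (h.nonneg i) (h.summable i) (hf.pairing N ∘L h.truncFlow N t)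
    refine h1.congr_fun fun k => ?_
    by_cases hk : r i k = 0
    · simp [hk]
    · rw [ContinuousLinearMap.comp_apply, ContinuousLinearMap.comp_apply,
        h.pairing_truncFlow hf (h.conserved i k hk).le, h.pairing_truncFlow hf le_rfl, smul_eq_mul]
  · have hd : ∀ s, HasDerivAt (fun t => hf.pairing N (h.truncFlow N t (unit i)))
        (hf.pairing N (h.truncFlow N s (row r J i))) s := fun s => by
      have h1 := (hf.pairing N).hasFDerivAt.comp_hasDerivAt s
        (hasDerivAt_flow (h.bounded N) J (unit i) s)
      rw [genOp_unit, hrow] at h1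
      exact h1
    rw [intervalIntegral.integral_eq_sub_of_hasDerivAt (fun s _ => hd s)
      (hcont.intervalIntegrable _ _), h.pairing_truncFlow hf le_rfl, truncFlow, flow_zero]
    simp [hf.pairing_unit le_rfl, N]

/-- Propagation of Lipschitz bounds: if the coupled jumps expand `w` at rate at most `c`, then
Lipschitz constants grow at most by `exp (c * t)`. -/
theorem GradedRates.abs_expect_sub_le {w : S → S → ℝ} {ℓ : I → ℝ} {c K : ℝ} (hc : 0 ≤ c)
    (hK : 0 ≤ K) (hfw : ∀ i j, |f i - f j| ≤ K * w i j)
    (hJJ : ∀ i j k, r i k ≠ 0 → r j k ≠ 0 → w (J i k) (J j k) ≤ w i j)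
    (hJ : ∀ i j k, w (J i k) j ≤ w i j + ℓ k) (hJ' : ∀ i j k, w i (J j k) ≤ w i j + ℓ k)
    (hsum : ∀ i j, Summable fun k => |r i k - r j k| * ℓ k)
    (hle : ∀ i j, ∑' k, |r i k - r j k| * ℓ k ≤ c * w i j) (t : ℝ≥0) (i j : S) :
    |h.expect f t i - h.expect f t j| ≤ K * Real.exp (c * t) * w i j := by
  -- The two states may have different levels, but one uniformized chain must serve both.
  obtain ⟨N, hi, hj⟩ : ∃ N, d i ≤ N ∧ d j ≤ N := ⟨max (d i) (d j), le_max_left _ _, le_max_right _ _⟩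
  set Λ : ℝ := 2 * L * N + 1
  have hΛ : 0 < Λ := h.bound_pos N
  set A := stepOp (h.bounded N) J
  have hstep : ∀ (n : ℕ) (i : S), d i ≤ N → ∃ R,
      HasSum (fun k => r i k * (hf.pairing N ((A ^ n) (unit (J i k))) -
        hf.pairing N ((A ^ n) (unit i)))) R ∧
      hf.pairing N ((A ^ (n + 1)) (unit i)) = hf.pairing N ((A ^ n) (unit i)) + Λ⁻¹ * R := by
    intro n i hi
    refine ⟨_, hasSum_map_row J (h.nonneg i) (h.summable i) (hf.pairing N ∘L A ^ n), ?_⟩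
    rw [pow_succ, mul_apply_eq_comp, stepOp_unit, row_congr J (truncRate_of_le hi), map_add,
      map_add, map_smul, map_smul]
    rfl
  have htot : ∀ i, d i ≤ N → ∑' k, r i k ≤ L * N := fun i hi =>
    (h.tsum_le i).trans (mul_le_mul_of_nonneg_left (Nat.cast_le.2 hi) h.pos.le)
  have key : ∀ (n : ℕ) (i j : S), d i ≤ N → d j ≤ N →
      |hf.pairing N ((A ^ n) (unit i)) - hf.pairing N ((A ^ n) (unit j))| ≤
        K * (1 + c / Λ) ^ n * w i j := by
    intro n
    induction n with
    | zero =>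
      intro i j hi hj
      simpa [hf.pairing_unit hi, hf.pairing_unit hj] using hfw i j
    | succ n ih =>
      intro i j hi hj
      obtain ⟨R, hR, e⟩ := hstep n i hi
      obtain ⟨R', hR', e'⟩ := hstep n j hj
      have hK' : 0 ≤ K * (1 + c / Λ) ^ n := by positivity
      have hJi : ∀ k, r i k ≠ 0 → d (J i k) ≤ N := fun k hk => (h.conserved i k hk).le.trans hi
      have hJj : ∀ k, r j k ≠ 0 → d (J j k) ≤ N := fun k hk => (h.conserved j k hk).le.trans hj
      have hΛ2 : ∑' k, r i k + ∑' k, r j k ≤ Λ := by linarith [htot i hi, htot j hj]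
      have b0 := abs_le.1 (ih i j hi hj)
      have b1 := fun k hk hk' => abs_le.1 ((ih _ _ (hJi k hk) (hJj k hk')).trans
        (mul_le_mul_of_nonneg_left (hJJ i j k hk hk') hK'))
      have b2 := fun k hk => abs_le.1 ((ih _ _ (hJi k hk) hj).trans
        (mul_le_mul_of_nonneg_left (hJ i j k) hK'))
      have b3 := fun k hk => abs_le.1 ((ih _ _ hi (hJj k hk)).trans
        (mul_le_mul_of_nonneg_left (hJ' i j k) hK'))
      have u1 := step_sub_step_le hΛ hK' (h.nonneg i) (h.nonneg j) (h.summable i) (h.summable j)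
        hΛ2 b0.2 (fun k hk hk' => (b1 k hk hk').2) (fun k hk => (b2 k hk).2)
        (fun k hk => (b3 k hk).2) (hsum i j) (hle i j) hR hR'
      -- The one-sided estimate with the roles of `i` and `j` exchanged gives the absolute value.
      have u2 := step_sub_step_le (W := w i j) (ℓ := ℓ) (c := c) hΛ hK' (h.nonneg j) (h.nonneg i)
        (h.summable j) (h.summable i) (by rwa [add_comm]) (by linarith [b0.1])
        (fun k hk hk' => by linarith [(b1 k hk' hk).1]) (fun k hk => by linarith [(b3 k hk).1])
        (fun k hk => by linarith [(b2 k hk).1])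
        (by simpa only [abs_sub_comm] using hsum i j)
        (by simpa only [abs_sub_comm] using hle i j) hR' hR
      rw [e, e', abs_le, pow_succ, ← mul_assoc]
      constructor <;> linarith
  have hser : ∀ i, d i ≤ N → HasSum (fun n : ℕ => Real.exp (-(t * Λ)) * ((t * Λ) ^ n / n.factorial) *
      hf.pairing N ((A ^ n) (unit i))) (h.expect f t i) := fun i hi => by
    rw [← h.pairing_truncFlow hf hi]
    have h1 := (hasSum_flow (h.bounded N) J hΛ.ne' t (unit i)).mapL (hf.pairing N)
    simp only [map_smul, smul_eq_mul] at h1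
    exact h1
  -- The mean of `(1 + c / Λ) ^ n` under the Poisson law of parameter `t * Λ` is `exp (c * t)`: the
  -- dependence on `Λ` cancels.
  have hexp : HasSum (fun n : ℕ => Real.exp (-(t * Λ)) * ((t * Λ) ^ n / n.factorial) *
      (K * (1 + c / Λ) ^ n * w i j)) (K * Real.exp (c * t) * w i j) := by
    have h1 := NormedSpace.expSeries_div_hasSum_exp (t * Λ * (1 + c / Λ))
    rw [← Real.exp_eq_exp_ℝ] at h1
    have h2 := h1.mul_left (Real.exp (-(t * Λ)) * K * w i j)
    have e : Real.exp (-(t * Λ)) * K * w i j * Real.exp (t * Λ * (1 + c / Λ)) =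
        K * Real.exp (c * t) * w i j := by
      have : Real.exp (c * t) = Real.exp (-(t * Λ)) * Real.exp (t * Λ * (1 + c / Λ)) := by
        rw [← Real.exp_add]; congr 1; field_simp; ring
      rw [this]; ring
    rw [e] at h2
    convert! h2 using 2 with n
    rw [mul_pow (t * Λ)]; ring
  have hdiff := (hser i hi).sub (hser j hj)
  rw [← hdiff.tsum_eq, ← Real.norm_eq_abs]
  refine tsum_of_norm_bounded hexp fun n => ?_
  have h0 : 0 ≤ Real.exp (-(t * Λ)) * ((t * Λ) ^ n / n.factorial) := by positivity
  rw [← mul_sub, norm_mul, Real.norm_of_nonneg h0, Real.norm_eq_abs]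
  exact mul_le_mul_of_nonneg_left (key n i j hi hj) h0

end Graded

end JumpProcess

end

noncomputable section

namespace JumpProcess

/-! ### Summable families with a bound on the sum -/

/-- `f` is summable with sum at most `B`. -/
def SumLe {ι : Type*} (f : ι → ℝ) (B : ℝ) : Prop := Summable f ∧ ∑' i, f i ≤ B

section SumLe

variable {ι κ : Type*} {f g : ι → ℝ} {A B : ℝ}

theorem SumLe.add (hf : SumLe f A) (hg : SumLe g B) : SumLe (fun i => f i + g i) (A + B) :=
  ⟨hf.1.add hg.1, by rw [hf.1.tsum_add hg.1]; exact add_le_add hf.2 hg.2⟩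

theorem SumLe.const_mul (hf : SumLe f A) {c : ℝ} (hc : 0 ≤ c) :
    SumLe (fun i => c * f i) (c * A) :=
  ⟨hf.1.mul_left c, by rw [tsum_mul_left]; exact mul_le_mul_of_nonneg_left hf.2 hc⟩

theorem SumLe.trans (hf : SumLe f A) (h : A ≤ B) : SumLe f B := ⟨hf.1, hf.2.trans h⟩

theorem SumLe.of_le (hg : SumLe g B) (h0 : ∀ i, 0 ≤ f i) (h : ∀ i, f i ≤ g i) : SumLe f B :=
  have hf := Summable.of_nonneg_of_le h0 h hg.1
  ⟨hf, (hf.tsum_le_tsum h hg.1).trans hg.2⟩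

theorem SumLe.prod {f : ι × κ → ℝ} {u : ι → ℝ} (h0 : ∀ z, 0 ≤ f z)
    (h : ∀ i, SumLe (fun k => f (i, k)) (u i)) (hu : SumLe u B) : SumLe f B := by
  have h1 : SumLe (fun i => ∑' k, f (i, k)) B :=
    hu.of_le (fun i => tsum_nonneg fun k => h0 _) fun i => (h i).2
  have h2 : Summable f := (summable_prod_of_nonneg h0).2 ⟨fun i => (h i).1, h1.1⟩
  exact ⟨h2, by rw [h2.tsum_prod]; exact h1.2⟩

theorem SumLe.prod_swap {f : ι × κ → ℝ} {u : κ → ℝ} (h0 : ∀ z, 0 ≤ f z)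
    (h : ∀ k, SumLe (fun i => f (i, k)) (u k)) (hu : SumLe u B) : SumLe f B := by
  have h1 : SumLe (f ∘ Prod.swap) B := SumLe.prod (fun z => h0 _) h hu
  refine ⟨(Equiv.prodComm κ ι).summable_iff.1 h1.1, ?_⟩
  rw [← (Equiv.prodComm κ ι).tsum_eq f]
  exact h1.2

theorem SumLe.prod_assoc {μ : Type*} {f : ι × κ × μ → ℝ} {u : ι × κ → ℝ} (h0 : ∀ z, 0 ≤ f z)
    (h : ∀ i k, SumLe (fun m => f (i, k, m)) (u (i, k))) (hu : SumLe u B) : SumLe f B := by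
  have h1 : SumLe (f ∘ Equiv.prodAssoc ι κ μ) B :=
    SumLe.prod (fun z => h0 _) (fun z => h z.1 z.2) hu
  refine ⟨(Equiv.prodAssoc ι κ μ).summable_iff.1 h1.1, ?_⟩
  rw [← (Equiv.prodAssoc ι κ μ).tsum_eq f]
  exact h1.2

theorem SumLe.of_finset {s : Finset ι} (h : ∀ i, i ∉ s → f i = 0) (hs : ∑ i ∈ s, f i ≤ B) :
    SumLe f B :=
  ⟨(hasSum_sum_of_ne_finset_zero h).summable,
    (hasSum_sum_of_ne_finset_zero h).tsum_eq.trans_le hs⟩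

end SumLe

end JumpProcess

namespace MassMigration

open Filter JumpProcess

/-! ### The weighted distance -/

section Distance

variable {X : Type*} {a : X → ℝ}

theorem summable_wdist (ha : ∀ x, 0 < a x) (η ζ : Config a) :
    Summable fun x => |(η.1 x : ℝ) - ζ.1 x| * a x := by
  refine Summable.of_nonneg_of_le (fun x => mul_nonneg (abs_nonneg _) (ha x).le) (fun x => ?_)
    (η.2.add ζ.2)
  rw [← add_mul]
  refine mul_le_mul_of_nonneg_right ((abs_sub _ _).trans ?_) (ha x).le
  simp

theorem wdist_nonneg (ha : ∀ x, 0 < a x) (η ζ : Config a) : 0 ≤ wdist η ζ :=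
  tsum_nonneg fun x => mul_nonneg (abs_nonneg _) (ha x).le

theorem wdist_self (η : Config a) : wdist η η = 0 := by simp [wdist]

theorem wdist_comm (η ζ : Config a) : wdist η ζ = wdist ζ η := by
  simp only [wdist, abs_sub_comm]

theorem wdist_triangle (ha : ∀ x, 0 < a x) (η ζ ξ : Config a) :
    wdist η ξ ≤ wdist η ζ + wdist ζ ξ := by
  unfold wdist
  rw [← (summable_wdist ha η ζ).tsum_add (summable_wdist ha ζ ξ)]
  refine (summable_wdist ha η ξ).tsum_le_tsum (fun x => ?_)
    ((summable_wdist ha η ζ).add (summable_wdist ha ζ ξ))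
  rw [← add_mul]
  exact mul_le_mul_of_nonneg_right (abs_sub_le _ _ _) (ha x).le

/-- The weighted distance as a pseudometric. -/
abbrev Config.pseudoMetricSpace (ha : ∀ x, 0 < a x) : PseudoMetricSpace (Config a) where
  dist := wdist
  dist_self := wdist_self
  dist_comm := wdist_comm
  dist_triangle := wdist_triangle ha

theorem wdist_jump_self_le (ha : ∀ x, 0 < a x) (x y : X) (k : ℕ) (η : Config a) :
    wdist (η.jump x y k) η ≤ k * (a x + a y) := by
  classical
  have h1 : HasSum (fun z => (k : ℝ) * ((if z = x then a x else 0) + if z = y then a y else 0))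
      (k * (a x + a y)) :=
    ((hasSum_ite_eq x (a x)).add (hasSum_ite_eq y (a y))).mul_left _
  refine hasSum_le (fun z => ?_) (summable_wdist ha _ _).hasSum h1
  have hx := ha x
  have hy := ha y
  change |((jump x y k η.1 z : ℕ) : ℝ) - η.1 z| * a z ≤ _
  unfold jump
  by_cases h : k ≤ η.1 x ∧ x ≠ y
  · rw [if_pos h]
    by_cases hzx : z = x
    · subst hzx
      simp [Nat.cast_sub h.1, h.2]
    · by_cases hzy : z = y
      · subst hzy
        simp [hzx]
      · simp [hzx, hzy]
  · rw [if_neg h, sub_self, abs_zero, zero_mul]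
    split_ifs <;> positivity

/-- Either both configurations stay put or both change by the same amounts at `x` and `y`, so the
sitewise differences persist. -/
theorem wdist_jump_jump {x y : X} {k : ℕ} {η ζ : Config a} (h : k ≤ η.1 x ↔ k ≤ ζ.1 x) :
    wdist (η.jump x y k) (ζ.jump x y k) = wdist η ζ := by
  unfold wdist
  refine tsum_congr fun z => ?_
  congr 2
  change ((jump x y k η.1 z : ℕ) : ℝ) - ((jump x y k ζ.1 z : ℕ) : ℝ) = _
  unfold jump
  by_cases h1 : k ≤ η.1 x ∧ x ≠ y
  · have h2 : k ≤ ζ.1 x ∧ x ≠ y := ⟨h.1 h1.1, h1.2⟩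
    rw [if_pos h1, if_pos h2]
    by_cases hzx : z = x
    · subst hzx
      simp [Nat.cast_sub h1.1, Nat.cast_sub h2.1]
    · by_cases hzy : z = y
      · subst hzy
        simp [hzx]
      · simp [hzx, hzy]
  · have h2 : ¬(k ≤ ζ.1 x ∧ x ≠ y) := fun h3 => h1 ⟨h.2 h3.1, h3.2⟩
    rw [if_neg h1, if_neg h2]

theorem wdist_jump_left_le (ha : ∀ x, 0 < a x) (x y : X) (k : ℕ) (η ζ : Config a) :
    wdist (η.jump x y k) ζ ≤ wdist η ζ + k * (a x + a y) := by
  linarith [wdist_triangle ha (η.jump x y k) η ζ, wdist_jump_self_le ha x y k η]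

theorem wdist_jump_right_le (ha : ∀ x, 0 < a x) (x y : X) (k : ℕ) (η ζ : Config a) :
    wdist η (ζ.jump x y k) ≤ wdist η ζ + k * (a x + a y) := by
  rw [wdist_comm, wdist_comm η ζ]
  exact wdist_jump_left_le ha x y k ζ η

/-! ### Density of finite configurations and extension of Lipschitz functions. -/

open Classical in
/-- The restriction of a configuration to a finite set of sites. -/
def restrict (η : Config a) (F : Finset X) : X →₀ ℕ :=
  Finsupp.onFinset F (fun x => if x ∈ F then η.1 x else 0) fun x hx => by
    by_contra h
    simp [h] at hx

open Classical in
theorem restrict_apply (η : Config a) (F : Finset X) (x : X) :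
    restrict η F x = if x ∈ F then η.1 x else 0 := rfl

theorem tendsto_wdist_restrict (η : Config a) :
    Tendsto (fun F => wdist (ofFinite a (restrict η F)) η) atTop (𝓝 0) := by
  classical
  have h1 : Tendsto (fun F : Finset X => ∑' x, (η.1 x : ℝ) * a x - ∑ x ∈ F, (η.1 x : ℝ) * a x) atTop
      (𝓝 (∑' x, (η.1 x : ℝ) * a x - ∑' x, (η.1 x : ℝ) * a x)) := η.2.hasSum.const_sub _
  rw [sub_self] at h1
  refine h1.congr fun F => ?_
  have h2 : HasSum (fun x => if x ∈ F then (η.1 x : ℝ) * a x else 0)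
      (∑ x ∈ F, (η.1 x : ℝ) * a x) := by
    have := hasSum_sum_of_ne_finset_zero (s := F) (L := .unconditional X)
      (f := fun x => if x ∈ F then (η.1 x : ℝ) * a x else 0) (fun x hx => by simp [hx])
    rwa [Finset.sum_congr rfl fun x hx => if_pos hx] at this
  rw [← (η.2.hasSum.sub h2).tsum_eq]
  refine tsum_congr fun x => ?_
  change _ = |((restrict η F x : ℕ) : ℝ) - η.1 x| * a x
  rw [restrict_apply]
  split_ifs <;> simp

theorem IsLip.tendsto_restrict {f : Config a → ℝ} {K : ℝ} (hf : IsLip K f) (η : Config a) :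
    Tendsto (fun F => f (ofFinite a (restrict η F))) atTop (𝓝 (f η)) := by
  rw [tendsto_iff_norm_sub_tendsto_zero]
  have h1 := (tendsto_wdist_restrict η).const_mul K
  rw [mul_zero] at h1
  exact squeeze_zero (fun _ => norm_nonneg _) (fun F => hf _ _) h1

theorem IsLip.abs (ha : ∀ x, 0 < a x) {f : Config a → ℝ} {K : ℝ} (hf : IsLip K f) :
    IsLip |K| f := fun η ζ =>
  (hf η ζ).trans (mul_le_mul_of_nonneg_right (le_abs_self K) (wdist_nonneg ha η ζ))

/-- Lipschitz functions that agree on the configurations with finitely many particles are equal. -/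
theorem Lip.ext_ofFinite {f f' : Lip a} (h : ∀ ξ, f.1 (ofFinite a ξ) = f'.1 (ofFinite a ξ)) :
    f = f' := by
  obtain ⟨K, hK⟩ := f.2
  obtain ⟨K', hK'⟩ := f'.2
  ext η
  have h1 := hK.tendsto_restrict η
  simp only [h] at h1
  exact tendsto_nhds_unique h1 (hK'.tendsto_restrict η)

/-- A Lipschitz bound on the configurations with finitely many particles extends. -/
theorem isLip_of_ofFinite (ha : ∀ x, 0 < a x) (f : Lip a) {K : ℝ}
    (h : ∀ ξ ξ', |f.1 (ofFinite a ξ) - f.1 (ofFinite a ξ')| ≤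
      K * wdist (ofFinite a ξ) (ofFinite a ξ')) : IsLip K f.1 := by
  obtain ⟨K', hK'⟩ := f.2
  intro η ζ
  have h1 := ((hK'.tendsto_restrict η).sub (hK'.tendsto_restrict ζ)).abs
  -- The sign of `K` is arbitrary, so the error of replacing the distance by its limit carries the
  -- factor `|K|`.
  have h2 : Tendsto (fun F => |K| * (wdist (ofFinite a (restrict η F)) η +
      wdist (ofFinite a (restrict ζ F)) ζ) + K * wdist η ζ) atTop
      (𝓝 (|K| * (0 + 0) + K * wdist η ζ)) :=
    (((tendsto_wdist_restrict η).add (tendsto_wdist_restrict ζ)).const_mul _).add_const _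
  rw [add_zero, mul_zero, zero_add] at h2
  refine le_of_tendsto_of_tendsto' h1 h2 fun F => (h _ _).trans ?_
  set η' := ofFinite a (restrict η F)
  set ζ' := ofFinite a (restrict ζ F)
  have h3 := wdist_triangle ha η' η ζ'
  have h4 := wdist_triangle ha η ζ ζ'
  have h5 := wdist_triangle ha η η' ζ
  have h6 := wdist_triangle ha η' ζ' ζ
  rw [wdist_comm ζ ζ'] at h4
  rw [wdist_comm η η'] at h5
  have h7 : |wdist η' ζ' - wdist η ζ| ≤ wdist η' η + wdist ζ' ζ := by
    rw [abs_le]; constructor <;> linarith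
  have h8 : K * (wdist η' ζ' - wdist η ζ) ≤ |K| * |wdist η' ζ' - wdist η ζ| := by
    rw [← abs_mul]; exact le_abs_self _
  linarith [mul_le_mul_of_nonneg_left h7 (abs_nonneg K)]

/-- Every Lipschitz function of the configurations with finitely many particles extends. -/
theorem exists_lip_extension (ha : ∀ x, 0 < a x) (u : (X →₀ ℕ) → ℝ) {K : ℝ} (hK : 0 ≤ K)
    (h : ∀ ξ ξ', |u ξ - u ξ'| ≤ K * wdist (ofFinite a ξ) (ofFinite a ξ')) :
    ∃ f : Lip a, ∀ ξ, f.1 (ofFinite a ξ) = u ξ := by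
  let := Config.pseudoMetricSpace ha
  have hinj : Function.Injective (ofFinite a) := fun ξ ξ' e =>
    DFunLike.coe_injective (congrArg Subtype.val e)
  have h1 : LipschitzOnWith K.toNNReal (fun η => u (Function.invFun (ofFinite a) η))
      (Set.range (ofFinite a)) := by
    refine LipschitzOnWith.of_dist_le_mul ?_
    rintro _ ⟨ξ, rfl⟩ _ ⟨ξ', rfl⟩
    rw [Function.leftInverse_invFun hinj, Function.leftInverse_invFun hinj, Real.coe_toNNReal _ hK]
    exact h ξ ξ'
  -- The McShane extension keeps the Lipschitz constant.
  obtain ⟨f, hf, he⟩ := h1.extend_real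
  refine ⟨⟨f, K, fun η ζ => ?_⟩, fun ξ => ?_⟩
  · have h2 := hf.dist_le_mul η ζ
    rwa [Real.coe_toNNReal _ hK] at h2
  · change f _ = _
    rw [← he ⟨ξ, rfl⟩]
    exact congrArg u (Function.leftInverse_invFun hinj ξ)

end Distance

end MassMigration

end

noncomputable section

namespace MassMigration

open Filter JumpProcess

/-! ### Estimates for the jump rates of the model -/

section Model

variable {X : Type*} {p : X → X → ℝ} {a : X → ℝ} {M m C : ℝ} {g : ℕ → ℕ → ℕ → ℝ}

/-- The rate of the jump of `i.2.2` particles from `i.1` to `i.2.1` in the configuration `η`. -/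
def jumpRate (p : X → X → ℝ) (g : ℕ → ℕ → ℕ → ℝ) (η : X → ℕ) (i : X × X × ℕ) : ℝ :=
  p i.1 i.2.1 * g i.2.2 (η i.1) (η i.2.1)

theorem IsRateFunction.nonneg' (hg : IsRateFunction g) (k α β : ℕ) : 0 ≤ g k α β := by
  rcases Nat.eq_zero_or_pos k with rfl | hk
  · rw [hg.zero]
  · rcases lt_or_ge α k with h | h
    · rw [hg.eq_zero k α β (Or.inl h)]
    · exact hg.nonneg k α β hk h

theorem IsRateFunction.le_of_ne_zero (hg : IsRateFunction g) {k α β : ℕ} (h : g k α β ≠ 0) :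
    k ≤ α := by
  by_contra h1
  exact h (hg.eq_zero k α β (Or.inl (not_le.1 h1)))

theorem jumpRate_nonneg (hp : IsTransitionProbability p) (hg : IsRateFunction g) (η : X → ℕ)
    (i : X × X × ℕ) : 0 ≤ jumpRate p g η i :=
  mul_nonneg (hp.nonneg _ _) (hg.nonneg' _ _ _)

theorem jumpRate_zero (hg : IsRateFunction g) (i : X × X × ℕ) : jumpRate p g 0 i = 0 := by
  rw [jumpRate, Pi.zero_apply, hg.eq_zero _ _ _ (Or.inr rfl), mul_zero]

theorem le_of_jumpRate_ne_zero (hg : IsRateFunction g) {η : X → ℕ} {i : X × X × ℕ}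
    (h : jumpRate p g η i ≠ 0) : i.2.2 ≤ η i.1 :=
  hg.le_of_ne_zero (right_ne_zero_of_mul h)

theorem LipschitzRates.sumLe (hL : LipschitzRates g C) (hg : IsRateFunction g) (α β γ δ : ℕ) :
    SumLe (fun k : ℕ => (k : ℝ) * |g k α β - g k γ δ|) (C * (|(α : ℝ) - γ| + |(β : ℝ) - δ|)) := by
  refine SumLe.of_finset (s := Finset.Icc 1 (max α γ)) (fun k hk => ?_) (hL α β γ δ)
  rcases Nat.eq_zero_or_pos k with rfl | hk0
  · simp
  · have : max α γ < k := by
      by_contra h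
      exact hk (Finset.mem_Icc.2 ⟨hk0, not_lt.1 h⟩)
    rw [hg.eq_zero k α β (Or.inl ((le_max_left _ _).trans_lt this)),
      hg.eq_zero k γ δ (Or.inl ((le_max_right _ _).trans_lt this))]
    simp

theorem sumLe_transition (hp : IsTransitionProbability p) (x : X) : SumLe (p x) 1 :=
  ⟨(hp.hasSum_one x).summable, (hp.hasSum_one x).tsum_eq.le⟩

theorem IsTransitionProbability.le_one (hp : IsTransitionProbability p) (x y : X) : p x y ≤ 1 :=
  le_hasSum (hp.hasSum_one x) y fun z _ => hp.nonneg x z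

theorem IsWeight.sumLe_right (ha : IsWeight p a M) (hp : IsTransitionProbability p) (x : X) :
    SumLe (fun y => p x y * a y) (M * a x) := by
  refine ⟨Summable.of_nonneg_of_le (fun y => mul_nonneg (hp.nonneg x y) (ha.pos y).le)
    (fun y => mul_le_of_le_one_left (ha.pos y).le (hp.le_one x y)) ha.summable, ?_⟩
  have h1 : 0 ≤ ∑' y, a y * p y x := tsum_nonneg fun y => mul_nonneg (ha.pos y).le (hp.nonneg y x)
  linarith [ha.bound x]

theorem IsWeight.sumLe_left (ha : IsWeight p a M) (hp : IsTransitionProbability p) (y : X) :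
    SumLe (fun x => a x * p x y) (M * a y) := by
  refine ⟨Summable.of_nonneg_of_le (fun x => mul_nonneg (ha.pos x).le (hp.nonneg x y))
    (fun x => mul_le_of_le_one_right (ha.pos x).le (hp.le_one x y)) ha.summable, ?_⟩
  have h1 : 0 ≤ ∑' x, p y x * a x := tsum_nonneg fun x => mul_nonneg (hp.nonneg y x) (ha.pos x).le
  linarith [ha.bound y]

/-- The rate at which the basic coupling expands the weighted distance. -/
def couplingRate (C M m : ℝ) : ℝ := C * (1 + 2 * |M| + |m|)

theorem couplingRate_pos (hC : 0 < C) : 0 < couplingRate C M m := by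
  unfold couplingRate
  positivity

/-- Of the four products, `b x * a x` uses row sums `1`, the two mixed ones use the weight bound
`M`, and `b y * a y` uses the column sums; hence `1 + 2 * |M| + |m|`. Absolute values avoid any
discussion of signs. -/
theorem sumLe_double (hp : IsTransitionProbability p) (ha : IsWeight p a M)
    (hm : ∀ y, SumLe (fun x => p x y) m) {b : X → ℝ} (hb : ∀ x, 0 ≤ b x) {B : ℝ}
    (hB : SumLe (fun x => b x * a x) B) (hC : 0 ≤ C) :
    SumLe (fun z : X × X => p z.1 z.2 * (a z.1 + a z.2) * (C * (b z.1 + b z.2)))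
      (couplingRate C M m * B) := by
  have hp0 := hp.nonneg
  have ha0 := fun x => (ha.pos x).le
  have hba : ∀ x, 0 ≤ b x * a x := fun x => mul_nonneg (hb x) (ha0 x)
  have hB1 : ∀ c : ℝ, SumLe (fun x => c * (b x * a x)) (|c| * B) := fun c =>
    ⟨hB.1.mul_left c, by
      rw [tsum_mul_left]
      exact (mul_le_mul_of_nonneg_right (le_abs_self c) (tsum_nonneg hba)).trans
        (mul_le_mul_of_nonneg_left hB.2 (abs_nonneg c))⟩
  have h1 : SumLe (fun z : X × X => b z.1 * a z.1 * p z.1 z.2) B :=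
    SumLe.prod (fun z => mul_nonneg (hba _) (hp0 _ _))
      (fun x => (sumLe_transition hp x).const_mul (hba x)) (by simpa using hB)
  have h2 : SumLe (fun z : X × X => b z.1 * (p z.1 z.2 * a z.2)) (|M| * B) :=
    SumLe.prod (fun z => mul_nonneg (hb _) (mul_nonneg (hp0 _ _) (ha0 _)))
      (fun x => ((ha.sumLe_right hp x).const_mul (hb x)).trans (by rw [mul_left_comm])) (hB1 M)
  have h3 : SumLe (fun z : X × X => b z.2 * (a z.1 * p z.1 z.2)) (|M| * B) :=
    SumLe.prod_swap (fun z => mul_nonneg (hb _) (mul_nonneg (ha0 _) (hp0 _ _)))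
      (fun y => ((ha.sumLe_left hp y).const_mul (hb y)).trans (by rw [mul_left_comm])) (hB1 M)
  have h4 : SumLe (fun z : X × X => b z.2 * a z.2 * p z.1 z.2) (|m| * B) :=
    SumLe.prod_swap (fun z => mul_nonneg (hba _) (hp0 _ _))
      (fun y => ((hm y).const_mul (hba y)).trans (by rw [mul_comm])) (hB1 m)
  convert! (((h1.add h2).add (h3.add h4)).const_mul hC) using 1
  · ext z; ring
  · unfold couplingRate; ring

/-- The total expansion of the weighted distance under the basic coupling. -/
theorem sumLe_coupling (hp : IsTransitionProbability p) (ha : IsWeight p a M)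
    (hm : ∀ y, SumLe (fun x => p x y) m) (hg : IsRateFunction g) (hC : 0 ≤ C)
    (hL : LipschitzRates g C) (η ζ : Config a) :
    SumLe (fun i : X × X × ℕ => |jumpRate p g η.1 i - jumpRate p g ζ.1 i| *
      (i.2.2 * (a i.1 + a i.2.1))) (couplingRate C M m * wdist η ζ) := by
  have ha0 := fun x => (ha.pos x).le
  refine SumLe.prod_assoc
    (fun i => mul_nonneg (abs_nonneg _)
      (mul_nonneg (Nat.cast_nonneg _) (add_nonneg (ha0 _) (ha0 _)))) (fun x y => ?_)
    (sumLe_double hp ha hm (b := fun x => |(η.1 x : ℝ) - ζ.1 x|) (fun x => abs_nonneg _)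
      ⟨summable_wdist ha.pos η ζ, le_rfl⟩ hC)
  have h1 := (hL.sumLe hg (η.1 x) (η.1 y) (ζ.1 x) (ζ.1 y)).const_mul
    (mul_nonneg (hp.nonneg x y) (add_nonneg (ha0 x) (ha0 y)))
  convert! h1 using 2 with k
  simp only [jumpRate]
  rw [← mul_sub, abs_mul, abs_of_nonneg (hp.nonneg x y)]
  ring

/-- The configuration without particles. -/
def Config.empty (a : X → ℝ) : Config a := ofFinite a 0

theorem Config.empty_val : (Config.empty a).1 = 0 := rfl

/-- This is the coupling estimate against the empty configuration, where all rates vanish. -/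
theorem sumLe_displacement (hp : IsTransitionProbability p) (ha : IsWeight p a M)
    (hm : ∀ y, SumLe (fun x => p x y) m) (hg : IsRateFunction g) (hC : 0 ≤ C)
    (hL : LipschitzRates g C) (η : Config a) :
    SumLe (fun i : X × X × ℕ => jumpRate p g η.1 i * (i.2.2 * (a i.1 + a i.2.1)))
      (couplingRate C M m * wdist η (Config.empty a)) := by
  have h1 := sumLe_coupling hp ha hm hg hC hL η (Config.empty a)
  simpa only [Config.empty_val, jumpRate_zero hg, sub_zero,
    abs_of_nonneg (jumpRate_nonneg hp hg _ _)] using h1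

theorem IsLip.abs_jump_sub_le (ha : ∀ x, 0 < a x) {f : Config a → ℝ} {K : ℝ} (hK : 0 ≤ K)
    (hf : IsLip K f) (η : Config a) (i : X × X × ℕ) :
    |f (η.jump i.1 i.2.1 i.2.2) - f η| ≤ K * (i.2.2 * (a i.1 + a i.2.1)) :=
  (hf _ _).trans (mul_le_mul_of_nonneg_left (wdist_jump_self_le ha _ _ _ _) hK)

theorem IsLip.norm_generatorTerm_le (hp : IsTransitionProbability p) (ha : ∀ x, 0 < a x)
    (hg : IsRateFunction g) {f : Config a → ℝ} {K : ℝ} (hK : 0 ≤ K)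
    (hf : IsLip K f) (η : Config a) (i : X × X × ℕ) :
    ‖generatorTerm p g f η i‖ ≤ K * (jumpRate p g η.1 i * (i.2.2 * (a i.1 + a i.2.1))) := by
  have h0 := jumpRate_nonneg hp hg η.1 i
  change ‖jumpRate p g η.1 i * _‖ ≤ _
  rw [norm_mul, Real.norm_of_nonneg h0, mul_left_comm]
  exact mul_le_mul_of_nonneg_left (hf.abs_jump_sub_le ha hK η i) h0

theorem summable_generatorTerm (hp : IsTransitionProbability p) (ha : IsWeight p a M)
    (hm : ∀ y, SumLe (fun x => p x y) m) (hg : IsRateFunction g) (hC : 0 ≤ C)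
    (hL : LipschitzRates g C) {f : Config a → ℝ} {K : ℝ} (hK : 0 ≤ K) (hf : IsLip K f)
    (η : Config a) : Summable (generatorTerm p g f η) :=
  Summable.of_norm_bounded ((sumLe_displacement hp ha hm hg hC hL η).const_mul hK).1
    (hf.norm_generatorTerm_le hp ha.pos hg hK η)

theorem abs_generator_le (hp : IsTransitionProbability p) (ha : IsWeight p a M)
    (hm : ∀ y, SumLe (fun x => p x y) m) (hg : IsRateFunction g) (hC : 0 ≤ C)
    (hL : LipschitzRates g C) {f : Config a → ℝ} {K : ℝ} (hK : 0 ≤ K) (hf : IsLip K f)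
    (η : Config a) :
    |generator p g f η| ≤ K * (couplingRate C M m * wdist η (Config.empty a)) := by
  have h1 := (sumLe_displacement hp ha hm hg hC hL η).const_mul hK
  exact (tsum_of_norm_bounded h1.1.hasSum (hf.norm_generatorTerm_le hp ha.pos hg hK η)).trans h1.2

/-- The generator is continuous along the restrictions to finite sets of sites. -/
theorem tendsto_generator_restrict (hp : IsTransitionProbability p) (ha : IsWeight p a M)
    (hm : ∀ y, SumLe (fun x => p x y) m) (hg : IsRateFunction g) (hC : 0 ≤ C)
    (hL : LipschitzRates g C) {f : Config a → ℝ} {K : ℝ} (hK : 0 ≤ K) (hf : IsLip K f)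
    (η : Config a) :
    Tendsto (fun F => generator p g f (ofFinite a (restrict η F))) atTop (𝓝 (generator p g f η)) := by
  classical
  set η' : Finset X → Config a := fun F => ofFinite a (restrict η F)
  have hdisp := (sumLe_displacement hp ha hm hg hC hL η).const_mul hK
  have hcoup := fun F => (sumLe_coupling hp ha hm hg hC hL (η' F) η).const_mul hK
  have hb1 : ∀ F i, ‖(jumpRate p g (η' F).1 i - jumpRate p g η.1 i) *
      (f ((η' F).jump i.1 i.2.1 i.2.2) - f (η' F))‖ ≤
      K * (|jumpRate p g (η' F).1 i - jumpRate p g η.1 i| * (i.2.2 * (a i.1 + a i.2.1))) :=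
    fun F i => by
      rw [norm_mul, Real.norm_eq_abs, mul_left_comm]
      exact mul_le_mul_of_nonneg_left (hf.abs_jump_sub_le ha.pos hK _ i) (abs_nonneg _)
  have hb2 : ∀ F i, ‖jumpRate p g η.1 i * (f ((η' F).jump i.1 i.2.1 i.2.2) - f (η' F))‖ ≤
      K * (jumpRate p g η.1 i * (i.2.2 * (a i.1 + a i.2.1))) := fun F i => by
    have h0 := jumpRate_nonneg hp hg η.1 i
    rw [norm_mul, Real.norm_of_nonneg h0, mul_left_comm]
    exact mul_le_mul_of_nonneg_left (hf.abs_jump_sub_le ha.pos hK _ i) h0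
  -- The change of rates is separated from the change of increments: the first sum tends to zero by
  -- the coupling estimate, the second converges by domination with the rates of `η`.
  have hsplit : ∀ F, generator p g f (η' F) =
      ∑' i : X × X × ℕ, (jumpRate p g (η' F).1 i - jumpRate p g η.1 i) *
        (f ((η' F).jump i.1 i.2.1 i.2.2) - f (η' F)) +
      ∑' i : X × X × ℕ, jumpRate p g η.1 i * (f ((η' F).jump i.1 i.2.1 i.2.2) - f (η' F)) := by
    intro F
    rw [← (Summable.of_norm_bounded (hcoup F).1 (hb1 F)).tsum_add
      (Summable.of_norm_bounded hdisp.1 (hb2 F))]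
    refine tsum_congr fun i => ?_
    rw [generatorTerm, jumpRate, jumpRate]
    ring
  have hlim1 : Tendsto (fun F => ∑' i : X × X × ℕ, (jumpRate p g (η' F).1 i - jumpRate p g η.1 i) *
      (f ((η' F).jump i.1 i.2.1 i.2.2) - f (η' F))) atTop (𝓝 0) := by
    have h1 := ((tendsto_wdist_restrict η).const_mul (couplingRate C M m)).const_mul K
    rw [mul_zero, mul_zero] at h1
    exact squeeze_zero_norm (fun F => (tsum_of_norm_bounded (hcoup F).1.hasSum (hb1 F)).trans
      (hcoup F).2) h1
  have hlim2 : Tendsto (fun F => ∑' i : X × X × ℕ,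
      jumpRate p g η.1 i * (f ((η' F).jump i.1 i.2.1 i.2.2) - f (η' F))) atTop
      (𝓝 (generator p g f η)) := by
    refine tendsto_tsum_of_dominated_convergence hdisp.1 (fun i => ?_)
      (Eventually.of_forall fun F i => hb2 F i)
    refine Tendsto.const_mul _ (Tendsto.sub ?_ (hf.tendsto_restrict η))
    rw [tendsto_iff_norm_sub_tendsto_zero]
    have h1 := (tendsto_wdist_restrict η).const_mul K
    rw [mul_zero] at h1
    refine squeeze_zero' (Eventually.of_forall fun _ => norm_nonneg _) ?_ h1
    -- Once `F` contains the departure site, the jump is possible for both configurations or for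
    -- neither, and preserves their distance.
    filter_upwards [eventually_ge_atTop {i.1}] with F hF
    refine (hf _ _).trans_eq ?_
    rw [wdist_jump_jump]
    change i.2.2 ≤ restrict η F i.1 ↔ _
    rw [restrict_apply, if_pos (Finset.singleton_subset_iff.1 hF)]
  have h := hlim1.add hlim2
  rw [zero_add] at h
  exact h.congr fun F => (hsplit F).symm

/-! ### The chain on the configurations with finitely many particles -/

open Classical in
/-- Jumps as maps of the space of configurations with finitely many particles. -/
def jumpFinite (ξ : X →₀ ℕ) (i : X × X × ℕ) : X →₀ ℕ :=
  if i.2.2 ≤ ξ i.1 ∧ i.1 ≠ i.2.1 then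
    ξ - Finsupp.single i.1 i.2.2 + Finsupp.single i.2.1 i.2.2
  else ξ

theorem coe_jumpFinite (ξ : X →₀ ℕ) (i : X × X × ℕ) :
    ⇑(jumpFinite ξ i) = jump i.1 i.2.1 i.2.2 ξ := by
  classical
  ext z
  unfold jumpFinite jump
  by_cases h : i.2.2 ≤ ξ i.1 ∧ i.1 ≠ i.2.1
  · rw [if_pos h, if_pos h, Finsupp.add_apply, Finsupp.tsub_apply, Finsupp.single_apply,
      Finsupp.single_apply]
    by_cases hx : z = i.1
    · subst hx
      simp [h.2.symm]
    · by_cases hy : z = i.2.1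
      · subst hy
        simp [h.2, hx]
      · simp [hx, hy, Ne.symm hx, Ne.symm hy]
  · rw [if_neg h, if_neg h]

theorem degree_jumpFinite (ξ : X →₀ ℕ) (i : X × X × ℕ) :
    (jumpFinite ξ i).degree = ξ.degree := by
  classical
  unfold jumpFinite
  split_ifs with h
  · have h1 : Finsupp.single i.1 i.2.2 ≤ ξ := Finsupp.single_le_iff.2 h.1
    conv_rhs => rw [← tsub_add_cancel_of_le h1]
    rw [map_add, map_add, Finsupp.degree_single, Finsupp.degree_single]
  · rfl

theorem jump_ofFinite (ξ : X →₀ ℕ) (i : X × X × ℕ) :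
    (ofFinite a ξ).jump i.1 i.2.1 i.2.2 = ofFinite a (jumpFinite ξ i) :=
  Subtype.ext (coe_jumpFinite ξ i).symm

/-- Taking `γ = 0` and `δ = β` in the Lipschitz condition bounds `∑ k * g k α β` by `C * α`; the
factor `k ≥ 1` may be dropped. -/
theorem sumLe_jumpRate_finite (hp : IsTransitionProbability p) (hg : IsRateFunction g) (hC : 0 ≤ C)
    (hL : LipschitzRates g C) (ξ : X →₀ ℕ) :
    SumLe (jumpRate p g ξ) (C * ξ.degree) := by
  have h1 : SumLe (fun x => C * (ξ x : ℝ)) (C * ξ.degree) := by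
    refine SumLe.of_finset (s := ξ.support) (fun x hx => ?_) ?_
    · rw [Finsupp.notMem_support_iff.1 hx, Nat.cast_zero, mul_zero]
    · rw [← Finset.mul_sum, Finsupp.degree_apply, Nat.cast_sum]
  have h2 : SumLe (fun z : X × X => C * (ξ z.1 : ℝ) * p z.1 z.2) (C * ξ.degree) :=
    SumLe.prod (fun z => mul_nonneg (by positivity) (hp.nonneg _ _))
      (fun x => by simpa using (sumLe_transition hp x).const_mul (by positivity : 0 ≤ C * (ξ x : ℝ)))
      h1
  refine SumLe.prod_assoc (jumpRate_nonneg hp hg ξ) (fun x y => ?_) h2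
  have h3 := (hL.sumLe hg (ξ x) (ξ y) 0 (ξ y)).const_mul (hp.nonneg x y)
  refine (h3.of_le (fun k => jumpRate_nonneg hp hg ξ _) fun k => ?_).trans ?_
  · refine mul_le_mul_of_nonneg_left ?_ (hp.nonneg x y)
    change g k (ξ x) (ξ y) ≤ _
    rw [hg.eq_zero k 0 (ξ y) (Or.inr rfl), sub_zero, abs_of_nonneg (hg.nonneg' _ _ _)]
    rcases Nat.eq_zero_or_pos k with rfl | hk
    · rw [hg.zero, mul_zero]
    · exact le_mul_of_one_le_left (hg.nonneg' _ _ _) (Nat.one_le_cast.2 hk)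
  · simp [mul_comm]

theorem gradedRates (hp : IsTransitionProbability p) (hg : IsRateFunction g) (hC : 0 < C)
    (hL : LipschitzRates g C) :
    GradedRates (fun ξ : X →₀ ℕ => jumpRate p g ξ) jumpFinite Finsupp.degree C where
  pos := hC
  nonneg ξ := jumpRate_nonneg hp hg ξ
  summable ξ := (sumLe_jumpRate_finite hp hg hC.le hL ξ).1
  tsum_le ξ := (sumLe_jumpRate_finite hp hg hC.le hL ξ).2
  conserved ξ i _ := degree_jumpFinite ξ i

theorem chainRate_eq_row (hp : IsTransitionProbability p) (hg : IsRateFunction g) (hC : 0 < C)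
    (hL : LipschitzRates g C) :
    chainRate p g = fun ξ ζ => row (fun ξ : X →₀ ℕ => jumpRate p g ξ) jumpFinite ξ ζ := by
  ext ξ ζ
  have h1 := hasSum_map_row jumpFinite (r := fun ξ : X →₀ ℕ => jumpRate p g ξ) (i := ξ)
    (jumpRate_nonneg hp hg ξ) (sumLe_jumpRate_finite hp hg hC.le hL ξ).1 (coord ζ)
  refine Eq.trans (tsum_congr fun i => ?_) h1.tsum_eq
  change _ = jumpRate p g ξ i * (unit (jumpFinite ξ i) ζ - unit ξ ζ)
  have h2 : (jump i.1 i.2.1 i.2.2 ξ = ζ) ↔ ζ = jumpFinite ξ i := by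
    rw [← coe_jumpFinite, DFunLike.coe_fn_eq, eq_comm]
  rw [unit_apply, unit_apply, jumpRate]
  congr 2
  · congr 1
    exact propext h2
  · congr 1
    exact propext eq_comm

/-- A configuration of at most `n` particles lies within `n * ∑' x, a x` of the empty one. -/
theorem levelBounded_of_isLip (ha : IsWeight p a M) {f : Config a → ℝ} {K : ℝ} (hK : 0 ≤ K)
    (hf : IsLip K f) : LevelBounded Finsupp.degree fun ξ => f (ofFinite a ξ) := by
  have hA : ∀ x, a x ≤ ∑' x, a x := fun x =>
    ha.summable.le_tsum x fun y _ => (ha.pos y).le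
  have hA0 : 0 ≤ ∑' x, a x := tsum_nonneg fun x => (ha.pos x).le
  intro n
  refine ⟨|f (Config.empty a)| + K * (n * ∑' x, a x), fun ξ hξ => ?_⟩
  have h1 : wdist (ofFinite a ξ) (Config.empty a) ≤ n * ∑' x, a x := by
    refine (SumLe.of_finset (s := ξ.support) (fun x hx => ?_) ?_).2
    · change |((ξ x : ℕ) : ℝ) - ((0 : ℕ) : ℝ)| * a x = 0
      simp [Finsupp.notMem_support_iff.1 hx]
    · refine le_trans (b := ∑ x ∈ ξ.support, (ξ x : ℝ) * ∑' x, a x) (Finset.sum_le_sum fun x _ => ?_) ?_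
      · change |((ξ x : ℕ) : ℝ) - ((0 : ℕ) : ℝ)| * a x ≤ _
        rw [Nat.cast_zero, sub_zero, Nat.abs_cast]
        exact mul_le_mul_of_nonneg_left (hA x) (Nat.cast_nonneg _)
      · rw [← Finset.sum_mul, ← Nat.cast_sum, ← Finsupp.degree_apply]
        exact mul_le_mul_of_nonneg_right (Nat.cast_le.2 hξ) hA0
  have h2 := (hf (ofFinite a ξ) (Config.empty a)).trans (mul_le_mul_of_nonneg_left h1 hK)
  have h3 := abs_sub_abs_le_abs_sub (f (ofFinite a ξ)) (f (Config.empty a))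
  linarith

end Model

end MassMigration

end

noncomputable section

namespace JumpProcess

open Filter MassMigration MeasureTheory

/-! ### Positivity, uniqueness of the law, and integrals over realizations. -/

section Expect

variable {S I : Type*} {r : S → I → ℝ} {J : S → I → S} {d : S → ℕ} {L : ℝ}

theorem GradedRates.law_nonneg (h : GradedRates r J d L) (t : ℝ≥0) (i j : S) :
    0 ≤ h.law t i j := h.isTransitionFunction.nonneg t i j

theorem GradedRates.expect_nonneg (h : GradedRates r J d L) {f : S → ℝ} (hf : ∀ i, 0 ≤ f i)
    (t : ℝ≥0) (i : S) : 0 ≤ h.expect f t i :=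
  tsum_nonneg fun j => mul_nonneg (h.law_nonneg t i j) (hf j)

theorem GradedRates.expect_one (h : GradedRates r J d L) (t : ℝ≥0) (i : S) :
    h.expect (fun _ => 1) t i = 1 := by
  simpa [GradedRates.expect] using (h.isTransitionFunction.hasSum_one t i).tsum_eq

/-- Every transition function with the rates of the jump process is the law of the process. -/
theorem GradedRates.eq_law (h : GradedRates r J d L) {P : ℝ≥0 → S → S → ℝ}
    (hP : IsTransitionFunction (fun i j => row r J i j) P) (t : ℝ≥0) (i j : S) :
    P t i j = h.law t i j := by
  refine hP.eq_of_rates_eqOn h.isTransitionFunction {j | d j = d i} (L * d i * 2)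
    (fun j _ => rfl) (fun j _ => hasSum_row_zero J (h.nonneg j) (h.summable j)) (fun j hj => ?_)
    (fun j hj l hl => ?_) t rfl j
  · rw [← norm_eq_tsum_abs]
    refine (JumpProcess.norm_row_le J (h.nonneg j) (h.summable j)).trans ?_
    have h1 := h.tsum_le j
    rw [show d j = d i from hj] at h1
    exact mul_le_mul_of_nonneg_right h1 zero_le_two
  · refine row_apply_eq_zero J (h.nonneg j) (h.summable j) ?_ fun k hk => ?_
    · rintro rfl; exact hl hj
    · rintro rfl; exact hl ((h.conserved j k hk).trans hj)

end Expect

/-- The expectation of a function of a random variable with countably many values. -/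
theorem integrable_and_integral_eq_of_countable {S Ω : Type*} [Countable S] [MeasurableSpace Ω]
    {μ : Measure Ω} {Z : Ω → S} (hZ : ∀ j, MeasurableSet {ω | Z ω = j}) {w f : S → ℝ} {s : ℝ}
    (hw : ∀ j, 0 ≤ w j) (hμ : ∀ j, μ {ω | Z ω = j} = ENNReal.ofReal (w j))
    (hs : HasSum (fun j => w j * f j) s) :
    Integrable (fun ω => f (Z ω)) μ ∧ s = ∫ ω, f (Z ω) ∂μ := by
  have hdisj : Pairwise (Function.onFun Disjoint fun j => {ω | Z ω = j}) := fun i j hij =>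
    Set.disjoint_left.2 fun ω hi hj => hij (hi.symm.trans hj)
  have huniv : ⋃ j, {ω | Z ω = j} = Set.univ := Set.eq_univ_of_forall fun ω =>
    Set.mem_iUnion.2 ⟨Z ω, rfl⟩
  have hreal : ∀ j, μ.real {ω | Z ω = j} = w j := fun j => by
    rw [Measure.real, hμ, ENNReal.toReal_ofReal (hw j)]
  have hfin : ∀ j, μ {ω | Z ω = j} ≠ ⊤ := fun j => by rw [hμ]; exact ENNReal.ofReal_ne_top
  have hcongr : ∀ (F : S → ℝ) j, ∫ ω in {ω | Z ω = j}, F (Z ω) ∂μ = w j * F j := fun F j => by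
    rw [setIntegral_congr_fun (g := fun _ => F j) (hZ j) fun ω hω => congrArg F hω,
      setIntegral_const, hreal, smul_eq_mul]
  have hint : IntegrableOn (fun ω => f (Z ω)) (⋃ j, {ω | Z ω = j}) μ := by
    refine integrableOn_iUnion_of_summable_integral_norm (fun j => ?_) ?_
    · refine IntegrableOn.congr_fun (f := fun _ => f j) (integrableOn_const (hfin j))
        (fun ω hω => (congrArg f hω).symm) (hZ j)
    · refine hs.summable.abs.congr fun j => ?_
      rw [hcongr (fun j => ‖f j‖) j, abs_mul, abs_of_nonneg (hw j), Real.norm_eq_abs]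
  have h1 := hasSum_integral_iUnion hZ hdisj hint
  rw [huniv, Measure.restrict_univ] at h1
  rw [huniv, integrableOn_univ] at hint
  refine ⟨hint, hs.unique ?_⟩
  simpa only [hcongr] using h1

end JumpProcess

namespace MassMigration

open Filter JumpProcess MeasureTheory

/-! ### The semigroup on Lipschitz functions. -/

section Semigroup

variable {X : Type*} {p : X → X → ℝ} {a : X → ℝ} {M m C : ℝ} {g : ℕ → ℕ → ℕ → ℝ}

/-- The expectation of `f` at time `t` for the chain with finitely many particles. -/
def finiteExpect (h : GradedRates (fun ξ : X →₀ ℕ => jumpRate p g ξ) jumpFinite Finsupp.degree C)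
    (f : Config a → ℝ) (t : ℝ≥0) (ξ : X →₀ ℕ) : ℝ :=
  h.expect (fun ξ => f (ofFinite a ξ)) t ξ

theorem Lip.exists_nonneg (ha : ∀ x, 0 < a x) (f : Lip a) : ∃ K, 0 ≤ K ∧ IsLip K f.1 :=
  let ⟨K, hK⟩ := f.2
  ⟨|K|, abs_nonneg K, hK.abs ha⟩

theorem Lip.levelBounded (ha : IsWeight p a M) (f : Lip a) :
    LevelBounded Finsupp.degree fun ξ => f.1 (ofFinite a ξ) :=
  let ⟨_, hK0, hK⟩ := Lip.exists_nonneg ha.pos f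
  levelBounded_of_isLip ha hK0 hK

variable (h : GradedRates (fun ξ : X →₀ ℕ => jumpRate p g ξ) jumpFinite Finsupp.degree C)

theorem abs_finiteExpect_sub_le (hp : IsTransitionProbability p) (ha : IsWeight p a M)
    (hm : ∀ y, SumLe (fun x => p x y) m) (hg : IsRateFunction g) (hL : LipschitzRates g C)
    {f : Config a → ℝ} {K : ℝ} (hK : 0 ≤ K) (hf : IsLip K f) (t : ℝ≥0) (ξ ξ' : X →₀ ℕ) :
    |finiteExpect h f t ξ - finiteExpect h f t ξ'| ≤
      K * Real.exp (couplingRate C M m * t) * wdist (ofFinite a ξ) (ofFinite a ξ') := by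
  have hcoup := fun ξ ξ' => sumLe_coupling hp ha hm hg h.pos.le hL (ofFinite a ξ) (ofFinite a ξ')
  refine h.abs_expect_sub_le (levelBounded_of_isLip ha hK hf)
    (w := fun ξ ξ' => wdist (ofFinite a ξ) (ofFinite a ξ'))
    (ℓ := fun i => i.2.2 * (a i.1 + a i.2.1)) (couplingRate_pos h.pos).le hK (fun _ _ => hf _ _)
    (fun ξ ξ' i hi hi' => ?_) (fun ξ ξ' i => ?_) (fun ξ ξ' i => ?_) (fun ξ ξ' => (hcoup ξ ξ').1)
    (fun ξ ξ' => (hcoup ξ ξ').2) t ξ ξ'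
  · rw [← jump_ofFinite, ← jump_ofFinite, wdist_jump_jump]
    exact iff_of_true (le_of_jumpRate_ne_zero hg hi) (le_of_jumpRate_ne_zero hg hi')
  · rw [← jump_ofFinite]
    exact wdist_jump_left_le ha.pos _ _ _ _ _
  · rw [← jump_ofFinite]
    exact wdist_jump_right_le ha.pos _ _ _ _ _

/-- The semigroup on Lipschitz functions that extends the semigroup of the chain. -/
theorem exists_extension (hp : IsTransitionProbability p) (ha : IsWeight p a M)
    (hm : ∀ y, SumLe (fun x => p x y) m) (hg : IsRateFunction g) (hL : LipschitzRates g C) :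
    ∃ S : ℝ≥0 → Lip a →ₗ[ℝ] Lip a,
      ∀ t f ξ, (S t f).1 (ofFinite a ξ) = finiteExpect h f.1 t ξ := by
  have h1 : ∀ (t : ℝ≥0) (f : Lip a), ∃ F : Lip a, ∀ ξ,
      F.1 (ofFinite a ξ) = finiteExpect h f.1 t ξ := fun t f => by
    obtain ⟨K, hK0, hK⟩ := Lip.exists_nonneg ha.pos f
    exact exists_lip_extension ha.pos _ (mul_nonneg hK0 (Real.exp_pos _).le)
      (abs_finiteExpect_sub_le h hp ha hm hg hL hK0 hK t)
  choose F hF using h1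
  refine ⟨fun t => { toFun := F t, map_add' := fun f f' => ?_, map_smul' := fun c f => ?_ }, hF⟩
  · refine Lip.ext_ofFinite fun ξ => ?_
    change _ = (F t f).1 _ + (F t f').1 _
    rw [hF, hF, hF]
    refine HasSum.tsum_eq ?_
    convert! (h.hasSum_expect (Lip.levelBounded ha f) t ξ).add
      (h.hasSum_expect (Lip.levelBounded ha f') t ξ) using 2
    exact mul_add _ _ _
  · refine Lip.ext_ofFinite fun ξ => ?_
    change _ = c * (F t f).1 _
    rw [hF, hF]
    refine HasSum.tsum_eq ?_
    convert! (h.hasSum_expect (Lip.levelBounded ha f) t ξ).mul_left c using 2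
    exact mul_left_comm _ _ _

variable {h} {S : ℝ≥0 → Lip a →ₗ[ℝ] Lip a}
  (hS : ∀ t f ξ, (S t f).1 (ofFinite a ξ) = finiteExpect h f.1 t ξ)
include hS

theorem isLip_semigroup (hp : IsTransitionProbability p) (ha : IsWeight p a M)
    (hm : ∀ y, SumLe (fun x => p x y) m) (hg : IsRateFunction g) (hL : LipschitzRates g C)
    (f : Lip a) (t : ℝ≥0) {K : ℝ} (hf : IsLip K f.1) :
    IsLip (K * Real.exp (couplingRate C M m * t)) (S t f).1 := by
  rcases le_or_gt 0 K with hK | hK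
  · refine isLip_of_ofFinite ha.pos _ fun ξ ξ' => ?_
    rw [hS, hS]
    exact abs_finiteExpect_sub_le h hp ha hm hg hL hK hf t ξ ξ'
  -- A negative Lipschitz constant forces all distances to vanish, and then any constant is
  -- admissible.
  · have hw : ∀ η ζ : Config a, wdist η ζ = 0 := fun η ζ => by
      have h1 := (abs_nonneg _).trans (hf η ζ)
      nlinarith [wdist_nonneg ha.pos η ζ]
    obtain ⟨K', hK'⟩ := (S t f).2
    intro η ζ
    have h1 := hK' η ζ
    rw [hw, mul_zero] at h1 ⊢
    exact h1

theorem hasSum_semigroup (ha : IsWeight p a M) (f : Lip a) (t : ℝ≥0) (ξ : X →₀ ℕ) :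
    HasSum (fun ζ => h.law t ξ ζ * f.1 (ofFinite a ζ)) ((S t f).1 (ofFinite a ξ)) := by
  rw [hS]
  exact h.hasSum_expect (Lip.levelBounded ha f) t ξ

theorem semigroup_zero (ha : IsWeight p a M) : S 0 = LinearMap.id := by
  refine LinearMap.ext fun f => Lip.ext_ofFinite fun ξ => ?_
  rw [hS]
  exact h.expect_zero (Lip.levelBounded ha f) ξ

theorem semigroup_add (ha : IsWeight p a M) (s t : ℝ≥0) : S (s + t) = S s ∘ₗ S t := by
  refine LinearMap.ext fun f => Lip.ext_ofFinite fun ξ => ?_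
  have h1 := hasSum_semigroup hS ha (S t f) s ξ
  simp only [hS t f] at h1
  rw [hS, LinearMap.comp_apply]
  exact (h.hasSum_expect_add (Lip.levelBounded ha f) s t ξ).unique h1

theorem semigroup_one (t : ℝ≥0) : S t (Lip.one a) = Lip.one a := by
  refine Lip.ext_ofFinite fun ξ => ?_
  rw [hS]
  exact h.expect_one t ξ

theorem semigroup_nonneg (t : ℝ≥0) (f : Lip a) (hf : ∀ η, 0 ≤ f.1 η) (η : Config a) :
    0 ≤ (S t f).1 η := by
  obtain ⟨K, hK⟩ := (S t f).2
  refine ge_of_tendsto' (hK.tendsto_restrict η) fun F => ?_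
  rw [hS]
  exact h.expect_nonneg (fun _ => hf _) t _

theorem exists_generator_ofFinite (ha : IsWeight p a M) (f : Lip a) (ξ : X →₀ ℕ) :
    ∃ D : ℝ → ℝ, Continuous D ∧
      (∀ t : ℝ≥0, generator p g (S t f).1 (ofFinite a ξ) = D t) ∧
      ∀ t : ℝ≥0, (S t f).1 (ofFinite a ξ) = f.1 (ofFinite a ξ) + ∫ s in (0 : ℝ)..t, D s := by
  obtain ⟨D, hD, h1, h2⟩ := h.exists_backward (Lip.levelBounded ha f) ξ
  refine ⟨D, hD, fun t => ?_, fun t => ?_⟩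
  · refine Eq.trans (tsum_congr fun i => ?_) (h1 t).tsum_eq
    rw [generatorTerm, jump_ofFinite, hS, hS]
    rfl
  · rw [hS]
    exact h2 t

theorem semigroup_integral [Countable X] (hp : IsTransitionProbability p) (ha : IsWeight p a M)
    (hm : ∀ y, SumLe (fun x => p x y) m) (hg : IsRateFunction g) (hL : LipschitzRates g C)
    (f : Lip a) (η : Config a) :
    (∀ α β : ℝ, IntervalIntegrable (fun s : ℝ => generator p g (S s.toNNReal f).1 η)
      volume α β) ∧
    ∀ t : ℝ≥0, (S t f).1 η =
      f.1 η + ∫ s in (0 : ℝ)..t, generator p g (S s.toNNReal f).1 η := by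
  obtain ⟨K, hK0, hK⟩ := Lip.exists_nonneg ha.pos f
  set c := couplingRate C M m
  have hc : 0 < c := couplingRate_pos h.pos
  have hSL : ∀ t : ℝ≥0, IsLip (K * Real.exp (c * t)) (S t f).1 := fun t =>
    isLip_semigroup hS hp ha hm hg hL f t hK
  have hSL0 : ∀ t : ℝ≥0, 0 ≤ K * Real.exp (c * t) := fun t => by positivity
  set η' : Finset X → Config a := fun F => ofFinite a (restrict η F)
  have hGlim : ∀ s : ℝ, Tendsto (fun F => generator p g (S s.toNNReal f).1 (η' F)) atTop
      (𝓝 (generator p g (S s.toNNReal f).1 η)) := fun s =>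
    tendsto_generator_restrict hp ha hm hg h.pos.le hL (hSL0 _) (hSL _) η
  have hGcont : ∀ F, Continuous fun s : ℝ => generator p g (S s.toNNReal f).1 (η' F) := fun F => by
    obtain ⟨D, hD, h1, -⟩ := exists_generator_ofFinite hS ha f (restrict η F)
    simp only [η', h1]
    exact hD.comp (NNReal.continuous_coe.comp continuous_real_toNNReal)
  set W := wdist η (Config.empty a)
  -- A bound uniform in `F`: eventually the restriction is within distance `1` of `η`, which
  -- explains `1 + W`.
  have hGbound : ∀ᶠ F in atTop, ∀ s : ℝ, ‖generator p g (S s.toNNReal f).1 (η' F)‖ ≤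
      K * Real.exp (c * s.toNNReal) * (c * (1 + W)) := by
    filter_upwards [(tendsto_wdist_restrict η).eventually_lt_const one_pos] with F hF s
    refine (abs_generator_le hp ha hm hg h.pos.le hL (hSL0 _) (hSL s.toNNReal) _).trans ?_
    refine mul_le_mul_of_nonneg_left (mul_le_mul_of_nonneg_left ?_ hc.le) (hSL0 _)
    exact (wdist_triangle ha.pos _ η _).trans (add_le_add_left hF.le _)
  have hbcont : Continuous fun s : ℝ => K * Real.exp (c * s.toNNReal) * (c * (1 + W)) := by
    fun_prop
  -- Countability of `X` makes `atTop` on `Finset X` countably generated, as required both for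
  -- measurability of the limit and for dominated convergence.
  have hmeas : StronglyMeasurable fun s : ℝ => generator p g (S s.toNNReal f).1 η :=
    stronglyMeasurable_of_tendsto atTop (fun F => (hGcont F).stronglyMeasurable)
      (tendsto_pi_nhds.2 hGlim)
  refine ⟨fun α β => ?_, fun t => ?_⟩
  · refine (hbcont.intervalIntegrable α β).mono_fun' hmeas.aestronglyMeasurable
      (Eventually.of_forall fun s => ?_)
    exact le_of_tendsto (hGlim s).norm (hGbound.mono fun F hF => hF s)
  · have h1 : Tendsto (fun F => ∫ s in (0 : ℝ)..t, generator p g (S s.toNNReal f).1 (η' F)) atTop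
        (𝓝 (∫ s in (0 : ℝ)..t, generator p g (S s.toNNReal f).1 η)) :=
      intervalIntegral.tendsto_integral_filter_of_dominated_convergence _
        (Eventually.of_forall fun F => (hGcont F).aestronglyMeasurable)
        (hGbound.mono fun F hF => Eventually.of_forall fun s _ => hF s)
        (hbcont.intervalIntegrable _ _) (Eventually.of_forall fun s _ => hGlim s)
    have h2 : ∀ F, (S t f).1 (η' F) =
        f.1 (η' F) + ∫ s in (0 : ℝ)..t, generator p g (S s.toNNReal f).1 (η' F) := fun F => by
      obtain ⟨D, -, h3, h4⟩ := exists_generator_ofFinite hS ha f (restrict η F)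
      simp only [η']
      rw [h4]
      congr 1
      refine intervalIntegral.integral_congr fun s hs => ?_
      rw [Set.uIcc_of_le (NNReal.coe_nonneg t)] at hs
      simp only [h3, Real.coe_toNNReal _ hs.1]
    refine tendsto_nhds_unique ((hSL t).tendsto_restrict η) ?_
    exact ((hK.tendsto_restrict η).add h1).congr fun F => (h2 F).symm

theorem isMarkovSemigroup [Countable X] (hp : IsTransitionProbability p) (ha : IsWeight p a M)
    (hm : ∀ y, SumLe (fun x => p x y) m) (hg : IsRateFunction g) (hL : LipschitzRates g C) :
    IsMarkovSemigroup S where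
  zero := semigroup_zero hS ha
  add := semigroup_add hS ha
  one := semigroup_one hS
  nonneg := semigroup_nonneg hS
  continuous f η := by
    obtain ⟨h1, h2⟩ := semigroup_integral hS hp ha hm hg hL f η
    simp only [h2]
    exact continuous_const.add
      ((intervalIntegral.continuous_primitive h1 0).comp NNReal.continuous_coe)

theorem integral_chain [Countable X] (hp : IsTransitionProbability p) (ha : IsWeight p a M)
    (hg : IsRateFunction g) (hL : LipschitzRates g C) (f : Lip a) (t : ℝ≥0) (ζ : X →₀ ℕ)
    {Ω : Type*} [MeasurableSpace Ω] (μ : Measure Ω) (Y : ℝ≥0 → Ω → X →₀ ℕ)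
    (hY : IsMarkovChain (chainRate p g) ζ μ Y) :
    Integrable (fun ω => f.1 (ofFinite a (Y t ω))) μ ∧
      (S t f).1 (ofFinite a ζ) = ∫ ω, f.1 (ofFinite a (Y t ω)) ∂μ := by
  obtain ⟨P, hP, hlaw⟩ := hY.law
  rw [chainRate_eq_row hp hg h.pos hL] at hP
  refine integrable_and_integral_eq_of_countable (f := fun ξ => f.1 (ofFinite a ξ))
    (hY.measurable t) (h.law_nonneg t ζ) (fun j => ?_) (hasSum_semigroup hS ha f t ζ)
  -- The law of `Y t` is read off from the joint law at the times `0` and `t`, since the event `Y 0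
  -- = ζ` has full measure.
  have h1 := hlaw 1 ![0, t] ![ζ, j] (by
    intro k l hkl
    fin_cases k <;> fin_cases l <;> simp_all) rfl rfl
  simp only [Finset.univ_unique, Fin.default_eq_zero, Finset.prod_singleton] at h1
  rw [← h.eq_law hP, show P t ζ j = P (t - 0) ζ j by rw [tsub_zero]]
  refine Eq.trans (measure_congr ?_) h1
  filter_upwards [hY.initial] with ω hω
  refine propext ?_
  change Y t ω = j ↔ ∀ k : Fin 2, Y (![0, t] k) ω = ![ζ, j] k
  simp [Fin.forall_fin_two, hω]

end Semigroup

end MassMigration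

end

theorem theorem2p2 {X : Type*} [Countable X]
    (p : X → X → ℝ) (hp : MassMigration.IsTransitionProbability p)
    (hirr : Matrix.IsIrreducible (Matrix.of p))
    (hcol : MassMigration.HasBoundedColumnSums p)
    (a : X → ℝ) (M : ℝ) (ha : MassMigration.IsWeight p a M)
    (g : ℕ → ℕ → ℕ → ℝ) (hg : MassMigration.IsRateFunction g)
    (C : ℝ) (hC : 0 < C) (hLip : MassMigration.LipschitzRates g C) :
    -- the series defining the generator converges absolutely on Lipschitz functions
    (∀ (f : MassMigration.Lip a) (η : MassMigration.Config a),
      Summable (MassMigration.generatorTerm p g f.1 η)) ∧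
    -- there is a Markov chain semigroup on the configurations with finitely many particles
    ∃ P : ℝ≥0 → (X →₀ ℕ) → (X →₀ ℕ) → ℝ,
      MassMigration.IsTransitionFunction (MassMigration.chainRate p g) P ∧
    ∃ (S : ℝ≥0 → MassMigration.Lip a →ₗ[ℝ] MassMigration.Lip a) (c : ℝ),
      MassMigration.IsMarkovSemigroup S ∧ 0 < c ∧
      ∀ (f : MassMigration.Lip a) (t : ℝ≥0),
        -- growth of the Lipschitz constants
        (∀ K : ℝ, MassMigration.IsLip K f.1 →
          MassMigration.IsLip (K * Real.exp (c * t)) (S t f).1) ∧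
        -- integrated Kolmogorov equation
        (∀ η : MassMigration.Config a,
          IntervalIntegrable (fun s : ℝ => MassMigration.generator p g (S s.toNNReal f).1 η)
            MeasureTheory.volume 0 t ∧
          (S t f).1 η = f.1 η +
            ∫ s in (0 : ℝ)..t, MassMigration.generator p g (S s.toNNReal f).1 η) ∧
        -- finitely many particles: for the transition function and for every realization of the chain
        (∀ ζ : X →₀ ℕ,
          HasSum (fun ξ => P t ζ ξ * f.1 (MassMigration.ofFinite a ξ))
            ((S t f).1 (MassMigration.ofFinite a ζ)) ∧
          ∀ (Ω : Type*) [MeasurableSpace Ω] (μ : MeasureTheory.Measure Ω)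
            [MeasureTheory.IsProbabilityMeasure μ] (Y : ℝ≥0 → Ω → X →₀ ℕ),
            MassMigration.IsMarkovChain (MassMigration.chainRate p g) ζ μ Y →
            MeasureTheory.Integrable
              (fun ω => f.1 (MassMigration.ofFinite a (Y t ω))) μ ∧
            (S t f).1 (MassMigration.ofFinite a ζ) =
              ∫ ω, f.1 (MassMigration.ofFinite a (Y t ω)) ∂μ) := by
  obtain ⟨m, hm⟩ := hcol
  have h := MassMigration.gradedRates hp hg hC hLip
  obtain ⟨S, hS⟩ := MassMigration.exists_extension h hp ha hm hg hLip
  refine ⟨fun f η => ?_, fun t ξ ζ => h.law t ξ ζ, ?_, S, MassMigration.couplingRate C M m,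
    MassMigration.isMarkovSemigroup hS hp ha hm hg hLip, MassMigration.couplingRate_pos hC,
    fun f t => ⟨fun K hK => MassMigration.isLip_semigroup hS hp ha hm hg hLip f t hK,
      fun η => ?_, fun ζ => ⟨MassMigration.hasSum_semigroup hS ha f t ζ,
        fun Ω _ μ _ Y hY => MassMigration.integral_chain hS hp ha hg hLip f t ζ μ Y hY⟩⟩⟩
  · obtain ⟨K, hK0, hK⟩ := MassMigration.Lip.exists_nonneg ha.pos f
    exact MassMigration.summable_generatorTerm hp ha hm hg hC.le hLip hK0 hK η
  · rw [MassMigration.chainRate_eq_row hp hg hC hLip]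
    exact h.isTransitionFunction
  · obtain ⟨h1, h2⟩ := MassMigration.semigroup_integral hS hp ha hm hg hLip f η
    exact ⟨h1 0 t, h2 t⟩
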